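/- **Definitions.** A product system of Hilbert spaces is a family $(\mathfrak H_t)_{t\ge 0}$ of complex Hilbert spaces (inner products are conjugate linear in the first argument) with $\mathfrak H_0=\mathbb C$ and unitaries $\mathfrak H_s\bar\otimes\mathfrak H_t\to\mathfrak H_{s+t}$, written as identifications, which are associative and for $s=0$ or $t=0$ are the canonical ones. No measurability or separability is required. A morphism is a family of bounded operators $w_t$ with $w_{s+t}=w_s\otimes w_t$ and $w_0=\mathrm{id}_{\mathbb C}$; it is isometric (unitary) if all $w_t$ are. A unit is a family $\xi_t\in\mathfrak H_t$ with $\xi_s\otimes\xi_t=\xi_{s+t}$ and $\xi_0=1$; it is unital if $\langle\xi_t,\xi_t\rangle=1$ for all $t$. A spatial product system is a product system with a chosen unital unit $\omega$, its reference unit. A product system is of type I if there is a set $S$ of units such that $t\mapsto\langle\xi_t,\xi'_t\rangle$ is continuous for all $\xi,\xi'\in S$ and such that, for every $t$, the vectors $\xi^n_{t_n}\otimes\dots\otimes\xi^1_{t_1}$ with $\xi^k\in S$, $t_n+\dots+t_1=t$, are total in $\mathfrak H_t$. The tensor product of two product systems is $(\mathfrak H^1_t\bar\otimes\mathfrak H^2_t)_{t\ge0}$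 with $(a\otimes b)\otimes(a'\otimes b')=(a\otimes a')\otimes(b\otimes b')$ for $a\in\mathfrak H^1_s$, $b\in\mathfrak H^2_s$, $a'\in\mathfrak H^1_t$, $b'\in\mathfrak H^2_t$. A product of spatial product systems $(\mathfrak H^\ell,\omega^\ell)$, $\ell=1,2$, is a spatial product system $(F,\omega)$ of Hilbert spaces with isometric morphisms $\mathfrak H^\ell\to F$ (regarded as inclusions) sending $\omega^\ell_t$ to $\omega_t$, such that for every $t$ the vectors $x_{t_n}\otimes\dots\otimes x_{t_1}$ with $t_n+\dots+t_1=t$ and each $x_{t_k}$ in $\mathfrak H^1_{t_k}$ or in $\mathfrak H^2_{t_k}$ are total in $F_t$, and $\langle x^1,x^2\rangle=\langle x^1,\omega^1_t\rangle\langle\omega^2_t,x^2\rangle$ for $x^1\in\mathfrak H^1_t$, $x^2\in\mathfrak H^2_t$. For $x_t$ taken from $\mathfrak H^1_t$ or from $\mathfrak H^2_t$ let $(x_t)^\ell=x_t$ if it is taken from $\mathfrak H^\ell_t$, and $(x_t)^\ell=\omega^\ell_t$ otherwise. **Proposition 6.8.** Let $(\mathfrak H^\ell,\omega^\ell)$ ($\ell=1,2$)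 be two spatial product systems of Hilbert spaces. They have a product. Let $(F,\omega)$ be any product of them. Then there is exactly one morphism $u=(u_t)_{t\ge0}$ from $F$ to the tensor product $(\mathfrak H^1_t\bar\otimes\mathfrak H^2_t)_{t\ge0}$ with $$u_t\colon x_{t_n}\otimes\dots\otimes x_{t_1}\longmapsto\bigl((x_{t_n})^1\otimes\dots\otimes(x_{t_1})^1\bigr)\otimes\bigl((x_{t_n})^2\otimes\dots\otimes(x_{t_1})^2\bigr)$$ for all $t_n+\dots+t_1=t$ and all $x_{t_k}$ in $\mathfrak H^1_{t_k}$ or in $\mathfrak H^2_{t_k}$. This morphism is isometric. If both systems are of type I, it is unitary, that is, every $u_t$ is a unitary $F_t\to\mathfrak H^1_t\bar\otimes\mathfrak H^2_t$. -/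

import Mathlib

open scoped TensorProduct NNReal
open UniformSpace

universe u v w

/-- Transport of vectors along an equality of time parameters, as a unitary. -/
noncomputable def timeCast {𝕜 : Type} [RCLike 𝕜] {H : ℝ≥0 → Type u} [∀ t, NormedAddCommGroup (H t)]
    [∀ t, InnerProductSpace 𝕜 (H t)] {s t : ℝ≥0} (h : s = t) : H s ≃ₗᵢ[𝕜] H t :=
  h ▸ LinearIsometryEquiv.refl 𝕜 (H s)

/-- A (tensor) product system of Hilbert spaces `(H t)`, `t ≥ 0`.  The unitaries
`H s ⊗̄ H t → H (s + t)` from the completed tensor products are given by their restrictions to the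
algebraic tensor products, i.e. by isometries with dense range (every such isometry extends to
exactly one unitary, and every unitary arises so).  They are associative, `H 0` is identified with
`𝕜`, and with this identification the multiplications by elements of `H 0` are the canonical
ones. -/
structure ProductSystem (𝕜 : Type) [RCLike 𝕜] where
  space : ℝ≥0 → Type u
  [normed : ∀ t, NormedAddCommGroup (space t)]
  [innerProduct : ∀ t, InnerProductSpace 𝕜 (space t)]
  [complete : ∀ t, CompleteSpace (space t)]
  mul : ∀ s t, space s ⊗[𝕜] space t →ₗᵢ[𝕜] space (s + t)
  denseRange_mul : ∀ s t, DenseRange (mul s t)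
  scalar : 𝕜 ≃ₗᵢ[𝕜] space 0
  mul_assoc : ∀ r s t (x : space r) (y : space s) (z : space t),
    timeCast (𝕜 := 𝕜) (add_assoc r s t) (mul (r + s) t (mul r s (x ⊗ₜ y) ⊗ₜ z)) =
      mul r (s + t) (x ⊗ₜ mul s t (y ⊗ₜ z))
  mul_scalar : ∀ s (x : space s) (b : 𝕜),
    timeCast (𝕜 := 𝕜) (add_zero s) (mul s 0 (x ⊗ₜ scalar b)) = b • x
  scalar_mul : ∀ t (b : 𝕜) (x : space t),
    timeCast (𝕜 := 𝕜) (zero_add t) (mul 0 t (scalar b ⊗ₜ x)) = b • x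

attribute [instance] ProductSystem.normed ProductSystem.innerProduct ProductSystem.complete

instance {𝕜 : Type} [RCLike 𝕜] : CoeFun (ProductSystem.{u} 𝕜) (fun _ => ℝ≥0 → Type u) := ⟨ProductSystem.space⟩

/-- The total time of a word whose letter `a` has time `τ a`. -/
def totalTime {W : Type*} (τ : W → ℝ≥0) : List W → ℝ≥0
  | [] => 0
  | a :: l => τ a + totalTime τ l

namespace ProductSystem

/-- The product `x_{t_n} ⊗ … ⊗ x_{t_1}` of the factors `f a ∈ E (τ a)`, where `a` runs through the
letters of a word (from left to right), as an element of `E (t_n + … + t_1)`.  The empty product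
is `1 ∈ 𝕜 = E 0`. -/
noncomputable def prod {𝕜 : Type} [RCLike 𝕜] (E : ProductSystem.{u} 𝕜) {W : Type*} (τ : W → ℝ≥0) (f : ∀ a, E (τ a)) :
    ∀ l : List W, E (totalTime τ l)
  | [] => E.scalar 1
  | a :: l => E.mul (τ a) (totalTime τ l) (f a ⊗ₜ E.prod τ f l)

/-- The products, taken in `E t`, of all words of total time `t`. -/
def prodsAt {𝕜 : Type} [RCLike 𝕜] (E : ProductSystem.{u} 𝕜) {W : Type*} (τ : W → ℝ≥0) (f : ∀ a, E (τ a)) (t : ℝ≥0) :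
    Set (E t) :=
  {x | ∃ (l : List W) (h : totalTime τ l = t), timeCast (𝕜 := 𝕜) (H := E) h (E.prod τ f l) = x}

/-- A unit `ξ_s ⊗ ξ_t = ξ_{s+t}`, `ξ_0 = 1`.  Over a field of scalars every unit is central. -/
structure Unit {𝕜 : Type} [RCLike 𝕜] (E : ProductSystem.{u} 𝕜) where
  val : ∀ t, E t
  mul_val : ∀ s t, E.mul s t (val s ⊗ₜ val t) = val (s + t)
  val_zero : val 0 = E.scalar 1

/-- A set of units is continuous if the semigroups `b ↦ ⟪ξ_t, b ξ'_t⟫ = ⟪ξ_t, ξ'_t⟫ b` on `𝕜` are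
(uniformly, that is, norm) continuous for all its members `ξ`, `ξ'`. -/
def IsContinuousSet {𝕜 : Type} [RCLike 𝕜] (E : ProductSystem.{u} 𝕜) (S : Set E.Unit) : Prop :=
  ∀ ξ ∈ S, ∀ ξ' ∈ S, Continuous fun t : ℝ≥0 => (inner 𝕜 (ξ.val t) (ξ'.val t) : 𝕜)

/-- A product system of Hilbert spaces is type I if it is generated, up to norm closure, by a
continuous set of units. -/
def IsTypeI {𝕜 : Type} [RCLike 𝕜] (E : ProductSystem.{u} 𝕜) : Prop :=
  ∃ S : Set E.Unit, E.IsContinuousSet S ∧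
    ∀ t, Dense (Submodule.span 𝕜
      (E.prodsAt (W := ℝ≥0 × S) (fun a => a.1) (fun a => a.2.1.val a.1) t) : Set (E t))

/-- A morphism of product systems of Hilbert spaces: bounded operators with
`w_{s+t} = w_s ⊗ w_t` and `w_0 = id`. -/
structure Morphism {𝕜 : Type} [RCLike 𝕜] (E : ProductSystem.{u} 𝕜) (F : ProductSystem.{v} 𝕜) where
  map : ∀ t, E t →L[𝕜] F t
  map_mul : ∀ s t (x : E s) (y : E t),
    map (s + t) (E.mul s t (x ⊗ₜ y)) = F.mul s t (map s x ⊗ₜ map t y)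
  map_scalar : ∀ b : 𝕜, map 0 (E.scalar b) = F.scalar b

def Morphism.IsIsometric {𝕜 : Type} [RCLike 𝕜] {E : ProductSystem.{u} 𝕜} {F : ProductSystem.{v} 𝕜} (f : Morphism E F) :
    Prop :=
  ∀ t, Isometry (f.map t)

def Morphism.IsUnitary {𝕜 : Type} [RCLike 𝕜] {E : ProductSystem.{u} 𝕜} {F : ProductSystem.{v} 𝕜} (f : Morphism E F) :
    Prop :=
  ∀ t, Isometry (f.map t) ∧ Function.Surjective (f.map t)

end ProductSystem

/-! ### The tensor product of two product systems of Hilbert spaces -/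

section Extension

variable {𝕜 : Type*} [RCLike 𝕜] {X : Type*} {Y : Type*} {Z : Type*} [NormedAddCommGroup X] [InnerProductSpace 𝕜 X]
  [NormedAddCommGroup Y] [InnerProductSpace 𝕜 Y] [NormedAddCommGroup Z] [InnerProductSpace 𝕜 Z]

/-- Extension of an isometry `f` along a dense isometric embedding `e`. -/
noncomputable def extendIsometry [CompleteSpace Z] (f : X →ₗᵢ[𝕜] Z) (e : X →ₗᵢ[𝕜] Y)
    (he : DenseRange e) : Y →ₗᵢ[𝕜] Z where
  toLinearMap := (f.toContinuousLinearMap.extend e.toContinuousLinearMap).toLinearMap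
  norm_map' := by
    have key (x : X) : f.toContinuousLinearMap.extend e.toContinuousLinearMap (e x) = f x :=
      f.toContinuousLinearMap.extend_eq (e := e.toContinuousLinearMap) he
        e.isometry.isUniformInducing x
    refine fun y => he.induction_on (p := fun y =>
      ‖f.toContinuousLinearMap.extend e.toContinuousLinearMap y‖ = ‖y‖) y ?_ ?_
    · exact isClosed_eq (ContinuousLinearMap.continuous _).norm continuous_norm
    · intro x
      rw [key, f.norm_map, e.norm_map]

theorem extendIsometry_apply [CompleteSpace Z] (f : X →ₗᵢ[𝕜] Z) (e : X →ₗᵢ[𝕜] Y)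
    (he : DenseRange e) (x : X) : extendIsometry f e he (e x) = f x :=
  f.toContinuousLinearMap.extend_eq (e := e.toContinuousLinearMap) he
    e.isometry.isUniformInducing x

variable {X' : Type*} {Y' : Type*} [NormedAddCommGroup X'] [InnerProductSpace 𝕜 X']
  [NormedAddCommGroup Y'] [InnerProductSpace 𝕜 Y']

theorem denseRange_mapIsometry (f : X →ₗᵢ[𝕜] Y) (g : X' →ₗᵢ[𝕜] Y') (hf : DenseRange f)
    (hg : DenseRange g) : DenseRange (TensorProduct.mapIsometry f g) := by
  have h : (LinearMap.range (TensorProduct.mapIsometry f g).toLinearMap).topologicalClosure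
      = ⊤ := by
    rw [eq_top_iff, ← TensorProduct.span_tmul_eq_top, Submodule.span_le]
    rintro _ ⟨y, y', rfl⟩
    have : ∀ p : Y × Y', p.1 ⊗ₜ[𝕜] p.2 ∈
        (LinearMap.range (TensorProduct.mapIsometry f g).toLinearMap).topologicalClosure := by
      intro p
      refine (hf.prodMap hg).induction_on (p := fun p : Y × Y' => p.1 ⊗ₜ[𝕜] p.2 ∈
        (LinearMap.range (TensorProduct.mapIsometry f g).toLinearMap).topologicalClosure) p ?_ ?_
      · exact (Submodule.isClosed_topologicalClosure _).preimage TensorProduct.continuous_tmul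
      · rintro ⟨x, x'⟩
        exact Submodule.le_topologicalClosure _ ⟨x ⊗ₜ x', by simp⟩
    exact this (y, y')
  intro z
  have hz : z ∈ (LinearMap.range
      (TensorProduct.mapIsometry f g).toLinearMap).topologicalClosure := h ▸ Submodule.mem_top
  exact hz

theorem inner_tensorExchange (a b : (X ⊗[𝕜] Y) ⊗[𝕜] (X' ⊗[𝕜] Y')) :
    (inner 𝕜 (TensorProduct.tensorTensorTensorComm 𝕜 X Y X' Y' a)
      (TensorProduct.tensorTensorTensorComm 𝕜 X Y X' Y' b) : 𝕜) = inner 𝕜 a b := by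
  induction a with
  | zero => simp
  | add a a' ha ha' => simp only [map_add, inner_add_left, ha, ha']
  | tmul p q =>
    induction b with
    | zero => simp
    | add b b' hb hb' => simp only [map_add, inner_add_right, hb, hb']
    | tmul p' q' =>
      induction p with
      | zero => simp
      | add _ _ h h' => simp only [TensorProduct.add_tmul, map_add, inner_add_left, h, h']
      | tmul x y =>
        induction q with
        | zero => simp
        | add _ _ h h' => simp only [TensorProduct.tmul_add, map_add, inner_add_left, h, h']
        | tmul x' y' =>
          induction p' with
          | zero => simp
          | add _ _ h h' => simp only [TensorProduct.add_tmul, map_add, inner_add_right, h, h']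
          | tmul x₁ y₁ =>
            induction q' with
            | zero => simp
            | add _ _ h h' =>
              simp only [TensorProduct.tmul_add, map_add, inner_add_right, h, h']
            | tmul x₁' y₁' =>
              simp only [TensorProduct.tensorTensorTensorComm_tmul, TensorProduct.inner_tmul]
              ring

/-- The middle-four exchange `(X ⊗ Y) ⊗ (X' ⊗ Y') → (X ⊗ X') ⊗ (Y ⊗ Y')` as a unitary. -/
noncomputable def tensorExchange :
    (X ⊗[𝕜] Y) ⊗[𝕜] (X' ⊗[𝕜] Y') ≃ₗᵢ[𝕜] (X ⊗[𝕜] X') ⊗[𝕜] (Y ⊗[𝕜] Y') :=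
  LinearEquiv.isometryOfInner (TensorProduct.tensorTensorTensorComm 𝕜 X Y X' Y')
    inner_tensorExchange

theorem tensorExchange_tmul (x : X) (y : Y) (x' : X') (y' : Y') :
    tensorExchange (𝕜 := 𝕜) ((x ⊗ₜ[𝕜] y) ⊗ₜ[𝕜] (x' ⊗ₜ[𝕜] y')) = (x ⊗ₜ[𝕜] x') ⊗ₜ[𝕜] (y ⊗ₜ[𝕜] y') :=
  TensorProduct.tensorTensorTensorComm_tmul 𝕜 x y x' y'

end Extension

namespace ProductSystem

section Tensor

variable {𝕜 : Type} [RCLike 𝕜] (A : ProductSystem.{u} 𝕜) (B : ProductSystem.{v} 𝕜)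

/-- The Hilbert space `A t ⊗̄ B t`. -/
abbrev TensorSpace (t : ℝ≥0) : Type (max u v) := Completion (A t ⊗[𝕜] B t)

noncomputable def tensorPreMul (s t : ℝ≥0) :
    (A s ⊗[𝕜] B s) ⊗[𝕜] (A t ⊗[𝕜] B t) →ₗᵢ[𝕜] TensorSpace A B (s + t) :=
  (Completion.toComplₗᵢ.comp (TensorProduct.mapIsometry (A.mul s t) (B.mul s t))).comp
    tensorExchange.toLinearIsometry

noncomputable def tensorMul (s t : ℝ≥0) :
    TensorSpace A B s ⊗[𝕜] TensorSpace A B t →ₗᵢ[𝕜] TensorSpace A B (s + t) :=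
  extendIsometry (tensorPreMul A B s t)
    (TensorProduct.mapIsometry Completion.toComplₗᵢ Completion.toComplₗᵢ)
    (denseRange_mapIsometry _ _ Completion.denseRange_coe Completion.denseRange_coe)

theorem tensorMul_coe (s t : ℝ≥0) (p : A s ⊗[𝕜] B s) (q : A t ⊗[𝕜] B t) :
    tensorMul A B s t ((p : TensorSpace A B s) ⊗ₜ (q : TensorSpace A B t)) =
      tensorPreMul A B s t (p ⊗ₜ q) :=
  extendIsometry_apply (tensorPreMul A B s t)
    (TensorProduct.mapIsometry Completion.toComplₗᵢ Completion.toComplₗᵢ) _ (p ⊗ₜ q)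

theorem tensorMul_tmul (s t : ℝ≥0) (a : A s) (b : B s) (a' : A t) (b' : B t) :
    tensorMul A B s t (((a ⊗ₜ[𝕜] b : A s ⊗[𝕜] B s) : TensorSpace A B s) ⊗ₜ
      ((a' ⊗ₜ[𝕜] b' : A t ⊗[𝕜] B t) : TensorSpace A B t)) =
      ((A.mul s t (a ⊗ₜ a') ⊗ₜ[𝕜] B.mul s t (b ⊗ₜ b') : A (s + t) ⊗[𝕜] B (s + t)) :
        TensorSpace A B (s + t)) := by
  rw [tensorMul_coe]
  rfl

theorem denseRange_tensorMul (s t : ℝ≥0) : DenseRange (tensorMul A B s t) := by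
  have h₁ : DenseRange (tensorPreMul A B s t) :=
    (Completion.denseRange_coe.comp
      (denseRange_mapIsometry _ _ (A.denseRange_mul s t) (B.denseRange_mul s t))
      (Completion.continuous_coe _)).comp
      (f := tensorExchange) (LinearIsometryEquiv.surjective _).denseRange
      (Completion.toComplₗᵢ.comp
        (TensorProduct.mapIsometry (A.mul s t) (B.mul s t))).continuous
  refine h₁.mono ?_
  rintro _ ⟨x, rfl⟩
  exact ⟨_, extendIsometry_apply _ _ _ x⟩

theorem timeCast_tmul {s t : ℝ≥0} (h : s = t) (a : A s) (b : B s) :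
    timeCast (𝕜 := 𝕜) (H := TensorSpace A B) h ((a ⊗ₜ[𝕜] b : A s ⊗[𝕜] B s) : TensorSpace A B s) =
      ((timeCast (𝕜 := 𝕜) (H := A) h a ⊗ₜ[𝕜] timeCast (𝕜 := 𝕜) (H := B) h b : A t ⊗[𝕜] B t) :
        TensorSpace A B t) := by
  subst h
  rfl

noncomputable def tensorScalarIsometry : 𝕜 →ₗᵢ[𝕜] TensorSpace A B 0 :=
  Completion.toComplₗᵢ.comp ((TensorProduct.lidIsometry 𝕜 𝕜).symm.trans
    (TensorProduct.congrIsometry A.scalar B.scalar)).toLinearIsometry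

theorem tensorScalarIsometry_apply (b : 𝕜) : tensorScalarIsometry A B b =
    ((A.scalar 1 ⊗ₜ[𝕜] B.scalar b : A 0 ⊗[𝕜] B 0) : TensorSpace A B 0) := rfl

/-- `𝕜 = 𝕜 ⊗ 𝕜 = A 0 ⊗̄ B 0`. -/
noncomputable def tensorScalar : 𝕜 ≃ₗᵢ[𝕜] TensorSpace A B 0 :=
  LinearIsometryEquiv.ofSurjective (tensorScalarIsometry A B) <| by
    have hd : DenseRange (tensorScalarIsometry A B) :=
      Completion.denseRange_coe.comp (LinearIsometryEquiv.surjective _).denseRange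
        (Completion.continuous_coe _)
    have hc : IsClosed (Set.range (tensorScalarIsometry A B)) :=
      (tensorScalarIsometry A B).isometry.isClosedEmbedding.isClosed_range
    rw [← Set.range_eq_univ, ← hc.closure_eq]
    exact hd.closure_range

theorem tensorMul_assoc (r s t : ℝ≥0) (x : TensorSpace A B r) (y : TensorSpace A B s)
    (z : TensorSpace A B t) :
    timeCast (𝕜 := 𝕜) (H := TensorSpace A B) (add_assoc r s t)
      (tensorMul A B (r + s) t (tensorMul A B r s (x ⊗ₜ y) ⊗ₜ z)) =
      tensorMul A B r (s + t) (x ⊗ₜ tensorMul A B s t (y ⊗ₜ z)) := by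
  refine Completion.induction_on₃ x y z ?_ ?_
  · apply isClosed_eq
    · refine (LinearIsometryEquiv.continuous _).comp ((LinearIsometry.continuous _).comp ?_)
      refine TensorProduct.continuous_tmul.comp (Continuous.prodMk ?_ (by fun_prop))
      exact (LinearIsometry.continuous _).comp
        (TensorProduct.continuous_tmul.comp (Continuous.prodMk (by fun_prop) (by fun_prop)))
    · refine (LinearIsometry.continuous _).comp ?_
      refine TensorProduct.continuous_tmul.comp (Continuous.prodMk (by fun_prop) ?_)
      exact (LinearIsometry.continuous _).comp
        (TensorProduct.continuous_tmul.comp (Continuous.prodMk (by fun_prop) (by fun_prop)))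
  · intro p q m
    induction p with
    | zero => simp only [Completion.coe_zero, TensorProduct.zero_tmul, map_zero]
    | add _ _ h h' => simp only [Completion.coe_add, TensorProduct.add_tmul, map_add, h, h']
    | tmul a b =>
      induction q with
      | zero =>
        simp only [Completion.coe_zero, TensorProduct.zero_tmul, TensorProduct.tmul_zero, map_zero]
      | add _ _ h h' =>
        simp only [Completion.coe_add, TensorProduct.add_tmul, TensorProduct.tmul_add, map_add,
          h, h']
      | tmul a' b' =>
        induction m with
        | zero => simp only [Completion.coe_zero, TensorProduct.tmul_zero, map_zero]
        | add _ _ h h' => simp only [Completion.coe_add, TensorProduct.tmul_add, map_add, h, h']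
        | tmul a'' b'' =>
          rw [tensorMul_tmul, tensorMul_tmul, tensorMul_tmul, tensorMul_tmul, timeCast_tmul,
            A.mul_assoc, B.mul_assoc]

theorem tensorMul_scalar (s : ℝ≥0) (x : TensorSpace A B s) (b : 𝕜) :
    timeCast (𝕜 := 𝕜) (H := TensorSpace A B) (add_zero s)
      (tensorMul A B s 0 (x ⊗ₜ tensorScalar A B b)) = b • x := by
  change timeCast (𝕜 := 𝕜) (H := TensorSpace A B) (add_zero s)
      (tensorMul A B s 0 (x ⊗ₜ tensorScalarIsometry A B b)) = b • x
  rw [tensorScalarIsometry_apply]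
  refine Completion.induction_on x ?_ ?_
  · apply isClosed_eq
    · refine (LinearIsometryEquiv.continuous _).comp ((LinearIsometry.continuous _).comp ?_)
      exact TensorProduct.continuous_tmul.comp (Continuous.prodMk (by fun_prop) (by fun_prop))
    · exact continuous_const_smul b
  · intro p
    induction p with
    | zero => simp only [Completion.coe_zero, TensorProduct.zero_tmul, map_zero, smul_zero]
    | add _ _ h h' =>
      simp only [Completion.coe_add, TensorProduct.add_tmul, map_add, h, h', smul_add]
    | tmul a a' =>
      rw [tensorMul_tmul, timeCast_tmul, A.mul_scalar, B.mul_scalar, one_smul,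
        TensorProduct.tmul_smul, Completion.coe_smul]

theorem tensorScalar_mul (t : ℝ≥0) (b : 𝕜) (x : TensorSpace A B t) :
    timeCast (𝕜 := 𝕜) (H := TensorSpace A B) (zero_add t)
      (tensorMul A B 0 t (tensorScalar A B b ⊗ₜ x)) = b • x := by
  change timeCast (𝕜 := 𝕜) (H := TensorSpace A B) (zero_add t)
      (tensorMul A B 0 t (tensorScalarIsometry A B b ⊗ₜ x)) = b • x
  rw [tensorScalarIsometry_apply]
  refine Completion.induction_on x ?_ ?_
  · apply isClosed_eq
    · refine (LinearIsometryEquiv.continuous _).comp ((LinearIsometry.continuous _).comp ?_)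
      exact TensorProduct.continuous_tmul.comp (Continuous.prodMk (by fun_prop) (by fun_prop))
    · exact continuous_const_smul b
  · intro p
    induction p with
    | zero => simp only [Completion.coe_zero, TensorProduct.tmul_zero, map_zero, smul_zero]
    | add _ _ h h' =>
      simp only [Completion.coe_add, TensorProduct.tmul_add, map_add, h, h', smul_add]
    | tmul a a' =>
      rw [tensorMul_tmul, timeCast_tmul, A.scalar_mul, B.scalar_mul, one_smul,
        TensorProduct.tmul_smul, Completion.coe_smul]

/-- The tensor product `(A t ⊗̄ B t)` of two product systems of Hilbert spaces, with
`(a ⊗ b)(a' ⊗ b') = a a' ⊗ b b'`. -/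
noncomputable def tensor : ProductSystem.{max u v} 𝕜 where
  space := TensorSpace A B
  mul := tensorMul A B
  denseRange_mul := denseRange_tensorMul A B
  scalar := tensorScalar A B
  mul_assoc := tensorMul_assoc A B
  mul_scalar := tensorMul_scalar A B
  scalar_mul := tensorScalar_mul A B

/-- The elementary tensor `a ⊗ b ∈ A t ⊗̄ B t`. -/
noncomputable def tmul {t : ℝ≥0} (a : A t) (b : B t) : (tensor A B) t :=
  ((a ⊗ₜ[𝕜] b : A t ⊗[𝕜] B t) : TensorSpace A B t)

end Tensor

end ProductSystem

/-! ### Spatial product systems and their product -/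

/-- A spatial product system of Hilbert spaces: a product system with a unital unit `ω`, the
reference unit. -/
structure SpatialProductSystem (𝕜 : Type) [RCLike 𝕜] extends ProductSystem.{u} 𝕜 where
  ref : toProductSystem.Unit
  inner_ref : ∀ t, (inner 𝕜 (ref.val t) (ref.val t) : 𝕜) = 1

namespace SpatialProductSystem

/-- Letters for the elementary products of two spatial product systems: a time `t` and an element
either of `A t` or of `B t`. -/
abbrev Letter {𝕜 : Type} [RCLike 𝕜] (A : SpatialProductSystem.{u} 𝕜) (B : SpatialProductSystem.{v} 𝕜) : Type (max u v) :=
  Σ t : ℝ≥0, A.space t ⊕ B.space t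

variable {𝕜 : Type} [RCLike 𝕜] {A : SpatialProductSystem.{u} 𝕜} {B : SpatialProductSystem.{v} 𝕜}

def Letter.time (x : Letter A B) : ℝ≥0 := x.1

/-- The letter as an element of `F t`, for morphisms `i : A → F`, `j : B → F`. -/
def Letter.embed {F : ProductSystem.{w} 𝕜} (i : A.Morphism F) (j : B.Morphism F) :
    ∀ x : Letter A B, F x.time
  | ⟨t, Sum.inl a⟩ => i.map t a
  | ⟨t, Sum.inr b⟩ => j.map t b

/-- `(x_t)¹`: the element itself if it comes from the first system, and otherwise the reference
unit of the first system. -/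
def Letter.fst : ∀ x : Letter A B, A.space x.time
  | ⟨_, Sum.inl a⟩ => a
  | ⟨t, Sum.inr _⟩ => A.ref.val t

/-- `(x_t)²`: the element itself if it comes from the second system, and otherwise the reference
unit of the second system. -/
def Letter.snd : ∀ x : Letter A B, B.space x.time
  | ⟨t, Sum.inl _⟩ => B.ref.val t
  | ⟨_, Sum.inr b⟩ => b

/-- `F`, with the embeddings `i` and `j`, is the product of the spatial product systems `A` and
`B`: it contains both as spatial subsystems, it is generated by them, and
`⟪a, b⟫ = ⟪a, ω¹⟫ ⟪ω², b⟫` for elements `a ∈ A t`, `b ∈ B t`. -/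
structure IsProduct {𝕜 : Type} [RCLike 𝕜] (A : SpatialProductSystem.{u} 𝕜) (B : SpatialProductSystem.{v} 𝕜)
    (F : SpatialProductSystem.{w} 𝕜) (i : A.Morphism F.toProductSystem)
    (j : B.Morphism F.toProductSystem) : Prop where
  isometric_left : i.IsIsometric
  isometric_right : j.IsIsometric
  map_ref_left : ∀ t, i.map t (A.ref.val t) = F.ref.val t
  map_ref_right : ∀ t, j.map t (B.ref.val t) = F.ref.val t
  dense_span : ∀ t, Dense (Submodule.span 𝕜
    (F.prodsAt Letter.time (Letter.embed i j) t) : Set (F.space t))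
  inner_map_map : ∀ t (a : A.space t) (b : B.space t),
    (inner 𝕜 (i.map t a) (j.map t b) : 𝕜) =
      inner 𝕜 a (A.ref.val t) * inner 𝕜 (B.ref.val t) b

/-- `U` extends the mapping
`x_{t_n} ⊗ … ⊗ x_{t_1} ↦ ((x_{t_n})¹ ⊗ … ⊗ (x_{t_1})¹) ⊗ ((x_{t_n})² ⊗ … ⊗ (x_{t_1})²)`. -/
def ExtendsReplacement {F : ProductSystem.{w} 𝕜} (i : A.Morphism F) (j : B.Morphism F)
    (U : F.Morphism (A.toProductSystem.tensor B.toProductSystem)) : Prop :=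
  ∀ l : List (Letter A B),
    U.map (totalTime Letter.time l) (F.prod Letter.time (Letter.embed i j) l) =
      ProductSystem.tmul A.toProductSystem B.toProductSystem
        (A.prod Letter.time Letter.fst l) (B.prod Letter.time Letter.snd l)

end SpatialProductSystem

/-! In the tensor product put `a ↦ a ⊗ ω²` and `b ↦ ω¹ ⊗ b`. The prescribed map then evaluates a
word with letters from both systems in the tensor product instead of in `F`. Equal letters have
equal inner products in both places, because `⟪a ⊗ ω², ω¹ ⊗ b⟫ = ⟪a, ω¹⟫ ⟪ω², b⟫` is the relation
imposed on a product.

These inner products determine the Gram matrix of all words (`JointProduct.inner_eq`). Two words of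
the same total time need not break at the same instants, but a letter of time `s + m` is a limit of
sums of products of letters of times `s` and `m`. So every word can be cut anywhere, up to closed
linear span, and inner products factor along a common cut (`JointProduct.mem_split`). Equal Gram
matrices give an isometry on the closed span, and it is multiplicative because words concatenate.
Totality of the words in `F` gives uniqueness. A product exists: take the closed spans of the words
inside the tensor product.

For type I systems the range of the isometry is a closed multiplicative family `K` containing all `a
⊗ ω²` and `ω¹ ⊗ b`. Multiplying the reference units by scalars of modulus one does not affect this,
and a suitable choice makes them continuous relative to the generating units
(`exists_continuous_ref`). For generating units `ξ`, `η` the vector `z_t = ξ_t ⊗ ω²_t + ω¹_t ⊗ η_t -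
ω¹_t ⊗ ω²_t` of `K_t` agrees with `ξ_t ⊗ η_t` to first order, so its `n`-fold power at time `t / n`
tends to `ξ_t ⊗ η_t` (`Unit.mem_of_hasDerivAt`, `Unit.tensor_mem`). Cutting one tensor factor along
the words of the other then gives every `a ⊗ b`. -/

/-! ### Operators on total sets, and isometries from Gram matrices. -/

theorem ContinuousLinearMap.map_mem_of_dense_span {𝕜 : Type*} [RCLike 𝕜] {X Y : Type*}
    [NormedAddCommGroup X] [NormedSpace 𝕜 X] [NormedAddCommGroup Y] [NormedSpace 𝕜 Y]
    (L : X →L[𝕜] Y) {S : Set X} {K : Submodule 𝕜 Y} (hK : IsClosed (K : Set Y))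
    (hL : ∀ x ∈ S, L x ∈ K) {x : X} (hx : x ∈ (Submodule.span 𝕜 S).topologicalClosure) :
    L x ∈ K := by
  have h1 : Submodule.span 𝕜 S ≤ K.comap L.toLinearMap := Submodule.span_le.2 hL
  have h2 : IsClosed ((K.comap L.toLinearMap : Submodule 𝕜 X) : Set X) :=
    hK.preimage L.continuous
  exact Submodule.topologicalClosure_minimal _ h1 h2 hx

theorem ContinuousLinearMap.eq_of_dense_span {𝕜 : Type*} [RCLike 𝕜] {X Y : Type*}
    [NormedAddCommGroup X] [NormedSpace 𝕜 X] [NormedAddCommGroup Y] [NormedSpace 𝕜 Y]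
    (L M : X →L[𝕜] Y) {S : Set X} (hL : ∀ x ∈ S, L x = M x) {x : X}
    (hx : x ∈ (Submodule.span 𝕜 S).topologicalClosure) : L x = M x := by
  have := (L - M).map_mem_of_dense_span (K := ⊥) (S := S) (by simp)
    (fun x hx => by simp [hL x hx]) hx
  simpa [sub_eq_zero] using this

theorem Submodule.mem_topologicalClosure_of_dense {𝕜 : Type*} [RCLike 𝕜] {X : Type*}
    [NormedAddCommGroup X] [NormedSpace 𝕜 X] {K : Submodule 𝕜 X} (hK : Dense (K : Set X)) (x : X) :
    x ∈ K.topologicalClosure := hK x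

/-- Two families with the same Gram matrix, the first of them total, are related by an isometry. -/
theorem exists_linearIsometry_of_inner_eq {𝕜 : Type*} [RCLike 𝕜] {X Y ι : Type*}
    [NormedAddCommGroup X] [InnerProductSpace 𝕜 X] [NormedAddCommGroup Y] [InnerProductSpace 𝕜 Y]
    [CompleteSpace Y] (f : ι → X) (g : ι → Y)
    (hf : Dense (Submodule.span 𝕜 (Set.range f) : Set X))
    (hfg : ∀ a b, (inner 𝕜 (f a) (f b) : 𝕜) = inner 𝕜 (g a) (g b)) :
    ∃ U : X →ₗᵢ[𝕜] Y, ∀ a, U (f a) = g a := by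
  classical
  have hin (p q : ι →₀ 𝕜) :
      (inner 𝕜 (Finsupp.linearCombination 𝕜 f p) (Finsupp.linearCombination 𝕜 f q) : 𝕜) =
        inner 𝕜 (Finsupp.linearCombination 𝕜 g p) (Finsupp.linearCombination 𝕜 g q) := by
    simp only [Finsupp.linearCombination_apply, Finsupp.sum, sum_inner, inner_sum,
      inner_smul_left, inner_smul_right, hfg]
  have hnorm (p : ι →₀ 𝕜) :
      ‖Finsupp.linearCombination 𝕜 f p‖ = ‖Finsupp.linearCombination 𝕜 g p‖ := by
    rw [@norm_eq_sqrt_re_inner 𝕜, @norm_eq_sqrt_re_inner 𝕜 Y, hin]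
  have hker : LinearMap.ker (Finsupp.linearCombination 𝕜 f).rangeRestrict ≤
      LinearMap.ker (Finsupp.linearCombination 𝕜 g) := by
    intro p hp
    rw [LinearMap.ker_rangeRestrict, LinearMap.mem_ker] at hp
    rw [LinearMap.mem_ker, ← norm_eq_zero, ← hnorm, hp, norm_zero]
  -- `V` chooses coefficients linearly. The choice is immaterial: by `hnorm`, coefficients with the
  -- same combination of the `f a` give the same combination of the `g a`.
  obtain ⟨V, hV⟩ := LinearMap.exists_rightInverse_of_surjective
    (Finsupp.linearCombination 𝕜 f).rangeRestrict (LinearMap.range_rangeRestrict _)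
  have hVx (x : LinearMap.range (Finsupp.linearCombination 𝕜 f)) :
      Finsupp.linearCombination 𝕜 f (V x) = x := congrArg Subtype.val (LinearMap.congr_fun hV x)
  let W : LinearMap.range (Finsupp.linearCombination 𝕜 f) →ₗᵢ[𝕜] Y :=
    { toLinearMap := (Finsupp.linearCombination 𝕜 g).comp V
      norm_map' := fun x => by
        rw [LinearMap.comp_apply, ← hnorm, hVx]
        rfl }
  have hd : DenseRange (LinearMap.range (Finsupp.linearCombination 𝕜 f)).subtypeₗᵢ := by
    have : Set.range (LinearMap.range (Finsupp.linearCombination 𝕜 f)).subtypeₗᵢ =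
        (Submodule.span 𝕜 (Set.range f) : Set X) := by
      rw [← Finsupp.range_linearCombination]
      ext x
      simp
    rw [DenseRange, this]
    exact hf
  refine ⟨extendIsometry W _ hd, fun a => ?_⟩
  have hfa : f a = Finsupp.linearCombination 𝕜 f (Finsupp.single a 1) := by simp
  have hmem : f a ∈ LinearMap.range (Finsupp.linearCombination 𝕜 f) := ⟨_, hfa.symm⟩
  have h1 := extendIsometry_apply W _ hd ⟨f a, hmem⟩
  refine h1.trans ?_
  change Finsupp.linearCombination 𝕜 g (V ⟨f a, hmem⟩) = g a
  have h2 : Finsupp.linearCombination 𝕜 f (V ⟨f a, hmem⟩ - Finsupp.single a 1) = 0 := by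
    rw [map_sub, hVx, ← hfa, sub_self]
  have h3 := hnorm (V ⟨f a, hmem⟩ - Finsupp.single a 1)
  rw [h2, norm_zero, eq_comm, norm_eq_zero, map_sub, sub_eq_zero] at h3
  rw [h3]
  simp

/-! ### Multiplication into a prescribed total time. -/

namespace ProductSystem

variable {𝕜 : Type} [RCLike 𝕜]

/-- The multiplication `E s × E t → E r` for `s + t = r`, as a continuous bilinear map. -/
noncomputable def mulAt (E : ProductSystem.{u} 𝕜) {s t r : ℝ≥0} (h : s + t = r) :
    E s →L[𝕜] E t →L[𝕜] E r :=
  LinearMap.mkContinuous₂ ((TensorProduct.mk 𝕜 (E s) (E t)).compr₂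
    ((timeCast (𝕜 := 𝕜) (H := E) h).toLinearEquiv.toLinearMap.comp (E.mul s t).toLinearMap)) 1 <| by
      intro x y
      have : ‖timeCast (𝕜 := 𝕜) (H := E) h (E.mul s t (x ⊗ₜ y))‖ ≤ 1 * ‖x‖ * ‖y‖ := by
        rw [LinearIsometryEquiv.norm_map, LinearIsometry.norm_map, TensorProduct.norm_tmul, one_mul]
      exact this

variable {E : ProductSystem.{u} 𝕜} {F : ProductSystem.{v} 𝕜}

theorem mulAt_apply {s t r : ℝ≥0} (h : s + t = r) (x : E s) (y : E t) :
    E.mulAt h x y = timeCast (𝕜 := 𝕜) (H := E) h (E.mul s t (x ⊗ₜ y)) := rfl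

theorem mulAt_rfl {s t : ℝ≥0} (x : E s) (y : E t) :
    E.mulAt rfl x y = E.mul s t (x ⊗ₜ y) := rfl

/-- All the sums of times are free, so reassociating a product introduces no transport between
fibres. -/
theorem mulAt_assoc {r s t p q m : ℝ≥0} (h₁ : r + s = p) (h₂ : p + t = m) (h₃ : s + t = q)
    (h₄ : r + q = m) (x : E r) (y : E s) (z : E t) :
    E.mulAt h₂ (E.mulAt h₁ x y) z = E.mulAt h₄ x (E.mulAt h₃ y z) := by
  subst h₁ h₃ h₄
  exact E.mul_assoc r s t x y z

theorem inner_mulAt {s t r : ℝ≥0} (h : s + t = r) (x x' : E s) (y y' : E t) :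
    (inner 𝕜 (E.mulAt h x y) (E.mulAt h x' y') : 𝕜) = inner 𝕜 x x' * inner 𝕜 y y' := by
  rw [mulAt_apply, mulAt_apply, LinearIsometryEquiv.inner_map_map, LinearIsometry.inner_map_map,
    TensorProduct.inner_tmul]

theorem mulAt_scalar {s : ℝ≥0} (h : s + 0 = s) (x : E s) (b : 𝕜) :
    E.mulAt h x (E.scalar b) = b • x := E.mul_scalar s x b

theorem scalar_mulAt {s : ℝ≥0} (h : 0 + s = s) (x : E s) (b : 𝕜) :
    E.mulAt h (E.scalar b) x = b • x := E.scalar_mul s b x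

theorem mulAt_one {s : ℝ≥0} (h : s + 0 = s) (x : E s) :
    E.mulAt h x (E.scalar 1) = x := by rw [mulAt_scalar, one_smul]

theorem one_mulAt {s : ℝ≥0} (h : 0 + s = s) (x : E s) :
    E.mulAt h (E.scalar 1) x = x := by rw [scalar_mulAt, one_smul]

theorem scalar_eq_smul (b : 𝕜) : E.scalar b = b • E.scalar 1 := by
  rw [← map_smul, smul_eq_mul, mul_one]

theorem inner_scalar_one : (inner 𝕜 (E.scalar 1) (E.scalar 1) : 𝕜) = 1 := by
  rw [LinearIsometryEquiv.inner_map_map]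
  simp

theorem Unit.mulAt_val (ξ : E.Unit) {s t r : ℝ≥0} (h : s + t = r) :
    E.mulAt h (ξ.val s) (ξ.val t) = ξ.val r := by
  subst h
  exact ξ.mul_val s t

theorem Morphism.map_mulAt (f : Morphism E F) {s t r : ℝ≥0} (h : s + t = r) (x : E s) (y : E t) :
    f.map r (E.mulAt h x y) = F.mulAt h (f.map s x) (f.map t y) := by
  subst h
  exact f.map_mul s t x y

theorem Morphism.ext {f g : Morphism E F} (h : ∀ t x, f.map t x = g.map t x) : f = g := by
  cases f
  cases g
  congr
  funext t
  exact ContinuousLinearMap.ext (h t)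

theorem Morphism.IsIsometric.inner_map {f : Morphism E F} (hf : f.IsIsometric) (t : ℝ≥0)
    (x y : E t) : (inner 𝕜 (f.map t x) (f.map t y) : 𝕜) = inner 𝕜 x y :=
  (f.map t).toLinearMap.toLinearIsometry (hf t) |>.inner_map_map x y

theorem Morphism.map_timeCast (f : Morphism E F) {s t : ℝ≥0} (h : s = t) (x : E s) :
    f.map t (timeCast (𝕜 := 𝕜) (H := E) h x) = timeCast (𝕜 := 𝕜) (H := F) h (f.map s x) := by
  subst h
  rfl

theorem mem_closure_span_mulAt {s t r : ℝ≥0} (h : s + t = r) (z : E r) :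
    z ∈ (Submodule.span 𝕜 {z | ∃ x y, E.mulAt h x y = z}).topologicalClosure := by
  subst h
  have hle : LinearMap.range (E.mul s t).toLinearMap ≤
      Submodule.span 𝕜 {z | ∃ x y, E.mulAt rfl x y = z} := by
    rw [LinearMap.range_eq_map, ← TensorProduct.span_tmul_eq_top, Submodule.map_span,
      Submodule.span_le]
    rintro _ ⟨_, ⟨x, y, rfl⟩, rfl⟩
    exact Submodule.subset_span ⟨x, y, rfl⟩
  exact closure_mono hle (E.denseRange_mul s t z)

theorem map_mem_of_mulAt {s t r : ℝ≥0} (h : s + t = r) {Y : Type*} [NormedAddCommGroup Y]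
    [NormedSpace 𝕜 Y] (L : E r →L[𝕜] Y) {K : Submodule 𝕜 Y} (hK : IsClosed (K : Set Y))
    (hL : ∀ x y, L (E.mulAt h x y) ∈ K) (z : E r) : L z ∈ K :=
  L.map_mem_of_dense_span hK (by rintro _ ⟨x, y, rfl⟩; exact hL x y) (mem_closure_span_mulAt h z)

theorem eq_of_mulAt {s t r : ℝ≥0} (h : s + t = r) {Y : Type*} [NormedAddCommGroup Y]
    [NormedSpace 𝕜 Y] (L M : E r →L[𝕜] Y)
    (hL : ∀ x y, L (E.mulAt h x y) = M (E.mulAt h x y)) (z : E r) : L z = M z :=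
  L.eq_of_dense_span M (by rintro _ ⟨x, y, rfl⟩; exact hL x y) (mem_closure_span_mulAt h z)

end ProductSystem

/-! ### Words evaluated in two systems at once, and their Gram matrix. -/

namespace ProductSystem

universe u₁ u₂ v₁ v₂

variable {𝕜 : Type} [RCLike 𝕜] {A : ProductSystem.{u₁} 𝕜} {B : ProductSystem.{u₂} 𝕜}
  {E : ProductSystem.{v₁} 𝕜} {E' : ProductSystem.{v₂} 𝕜}
  {i : A.Morphism E} {j : B.Morphism E} {i' : A.Morphism E'} {j' : B.Morphism E'}

/-- `x ∈ E t` and `x' ∈ E' t` are given by the same word with letters in `A` and `B`. -/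
inductive JointProduct (i : A.Morphism E) (j : B.Morphism E) (i' : A.Morphism E')
    (j' : B.Morphism E') : ∀ t, E t → E' t → Prop
  | one : JointProduct i j i' j' 0 (E.scalar 1) (E'.scalar 1)
  | left {s t r : ℝ≥0} (h : s + t = r) (a : A s) {x : E t} {x' : E' t}
      (hx : JointProduct i j i' j' t x x') :
      JointProduct i j i' j' r (E.mulAt h (i.map s a) x) (E'.mulAt h (i'.map s a) x')
  | right {s t r : ℝ≥0} (h : s + t = r) (b : B s) {x : E t} {x' : E' t}
      (hx : JointProduct i j i' j' t x x') :
      JointProduct i j i' j' r (E.mulAt h (j.map s b) x) (E'.mulAt h (j'.map s b) x')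

namespace JointProduct

theorem mul {s t r : ℝ≥0} (h : s + t = r) {x : E s} {x' : E' s} {y : E t} {y' : E' t}
    (hx : JointProduct i j i' j' s x x') (hy : JointProduct i j i' j' t y y') :
    JointProduct i j i' j' r (E.mulAt h x y) (E'.mulAt h x' y') := by
  induction hx generalizing r with
  | one =>
    obtain rfl : t = r := by simpa using h
    rwa [one_mulAt, one_mulAt]
  | @left p q m h' a x x' hx ih =>
    have h₄ : p + (q + t) = r := by rw [← add_assoc, h', h]
    rw [mulAt_assoc h' h rfl h₄, mulAt_assoc h' h rfl h₄]
    exact left h₄ a (ih rfl)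
  | @right p q m h' a x x' hx ih =>
    have h₄ : p + (q + t) = r := by rw [← add_assoc, h', h]
    rw [mulAt_assoc h' h rfl h₄, mulAt_assoc h' h rfl h₄]
    exact right h₄ a (ih rfl)

theorem map_left (t : ℝ≥0) (a : A t) : JointProduct i j i' j' t (i.map t a) (i'.map t a) := by
  have := left (j := j) (j' := j') (i := i) (i' := i') (add_zero t) a one
  rwa [mulAt_one, mulAt_one] at this

theorem map_right (t : ℝ≥0) (b : B t) : JointProduct i j i' j' t (j.map t b) (j'.map t b) := by
  have := right (j := j) (j' := j') (i := i) (i' := i') (add_zero t) b one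
  rwa [mulAt_one, mulAt_one] at this

/-- The pairs of words of total time `r = s + t` that can be cut at time `s`. -/
def splitSet (i : A.Morphism E) (j : B.Morphism E) (i' : A.Morphism E')
    (j' : B.Morphism E') {s t r : ℝ≥0} (h : s + t = r) : Set (E r × E' r) :=
  {z | ∃ x x' y y', JointProduct i j i' j' s x x' ∧ JointProduct i j i' j' t y y' ∧
    z = (E.mulAt h x y, E'.mulAt h x' y')}

/-- The induction step for cutting words. Working in `E r × E' r` ensures that one and the same
approximation serves both systems. -/
theorem mem_split_of_letter {C : ProductSystem.{w} 𝕜} (k : C.Morphism E) (k' : C.Morphism E')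
    (hk : ∀ (t : ℝ≥0) (c : C t), JointProduct i j i' j' t (k.map t c) (k'.map t c))
    {p q r : ℝ≥0} (h : p + q = r) (c : C p) {x : E q} {x' : E' q}
    (hx : JointProduct i j i' j' q x x')
    (ih : ∀ {s t : ℝ≥0} (h : s + t = q),
      (x, x') ∈ (Submodule.span 𝕜 (splitSet i j i' j' h)).topologicalClosure)
    {s t : ℝ≥0} (h' : s + t = r) :
    (E.mulAt h (k.map p c) x, E'.mulAt h (k'.map p c) x') ∈
      (Submodule.span 𝕜 (splitSet i j i' j' h')).topologicalClosure := by
  rcases le_total p s with hps | hsp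
  -- The cut falls behind the letter: cut the rest of the word and put the letter in front.
  · obtain ⟨m, rfl⟩ := exists_add_of_le hps
    have hm : m + t = q := by
      rw [← h, add_assoc] at h'
      exact add_left_cancel h'
    refine ((E.mulAt h (k.map p c)).prodMap (E'.mulAt h (k'.map p c))).map_mem_of_dense_span
      (Submodule.isClosed_topologicalClosure _) ?_ (ih hm)
    rintro _ ⟨x, x', y, y', hx, hy, rfl⟩
    refine Submodule.le_topologicalClosure _ (Submodule.subset_span
      ⟨E.mulAt rfl (k.map p c) x, E'.mulAt rfl (k'.map p c) x', y, y', (hk p c).mul rfl hx, hy, ?_⟩)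
    rw [mulAt_assoc rfl h' hm h, mulAt_assoc rfl h' hm h]
    rfl
  -- The cut falls inside the letter, which lies in the closed span of the products of elements of
  -- `C s` and `C m`.
  · obtain ⟨m, rfl⟩ := exists_add_of_le hsp
    have hm : m + q = t := by
      rw [← h', add_assoc] at h
      exact add_left_cancel h
    let L : C (s + m) →L[𝕜] E r × E' r :=
      (((E.mulAt h).flip x).comp (k.map (s + m))).prod
        (((E'.mulAt h).flip x').comp (k'.map (s + m)))
    refine C.map_mem_of_mulAt rfl L (Submodule.isClosed_topologicalClosure _) ?_ c
    intro a b
    refine Submodule.le_topologicalClosure _ (Submodule.subset_span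
      ⟨k.map s a, k'.map s a, E.mulAt hm (k.map m b) x, E'.mulAt hm (k'.map m b) x',
        hk s a, (hk m b).mul hm hx, ?_⟩)
    rw [← mulAt_assoc rfl h hm h', ← mulAt_assoc rfl h hm h', ← k.map_mulAt, ← k'.map_mulAt]
    rfl

/-- Every word can be cut at every time, up to closed linear span. -/
theorem mem_split {r : ℝ≥0} {x : E r} {x' : E' r} (hx : JointProduct i j i' j' r x x')
    {s t : ℝ≥0} (h : s + t = r) :
    (x, x') ∈ (Submodule.span 𝕜 (splitSet i j i' j' h)).topologicalClosure := by
  induction hx generalizing s t with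
  | one =>
    obtain ⟨rfl, rfl⟩ := add_eq_zero.1 h
    refine Submodule.le_topologicalClosure _ (Submodule.subset_span ⟨_, _, _, _, one, one, ?_⟩)
    rw [mulAt_one, mulAt_one]
  | left h' a hx ih => exact mem_split_of_letter i i' map_left h' a hx ih h
  | right h' b hx ih => exact mem_split_of_letter j j' map_right h' b hx ih h

/-- A single letter can be split along the first break of the word by density of products in `C`, so
the inner product factors and induction on the word applies. -/
theorem inner_letter {C : ProductSystem.{w} 𝕜} (k : C.Morphism E) (k' : C.Morphism E')
    (hi : ∀ t a c, (inner 𝕜 (i.map t a) (k.map t c) : 𝕜) = inner 𝕜 (i'.map t a) (k'.map t c))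
    (hj : ∀ t b c, (inner 𝕜 (j.map t b) (k.map t c) : 𝕜) = inner 𝕜 (j'.map t b) (k'.map t c))
    {t : ℝ≥0} {x : E t} {x' : E' t} (hx : JointProduct i j i' j' t x x') (c : C t) :
    (inner 𝕜 x (k.map t c) : 𝕜) = inner 𝕜 x' (k'.map t c) := by
  induction hx with
  | one =>
    obtain ⟨b, rfl⟩ := C.scalar.surjective c
    rw [k.map_scalar, k'.map_scalar, LinearIsometryEquiv.inner_map_map,
      LinearIsometryEquiv.inner_map_map]
  | @left s t r h a x x' hx ih =>
    refine C.eq_of_mulAt h ((innerSL 𝕜 (E.mulAt h (i.map s a) x)).comp (k.map r))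
      ((innerSL 𝕜 (E'.mulAt h (i'.map s a) x')).comp (k'.map r)) (fun c d => ?_) c
    simp only [ContinuousLinearMap.comp_apply, innerSL_apply_apply, Morphism.map_mulAt, inner_mulAt,
      hi, ih]
  | @right s t r h a x x' hx ih =>
    refine C.eq_of_mulAt h ((innerSL 𝕜 (E.mulAt h (j.map s a) x)).comp (k.map r))
      ((innerSL 𝕜 (E'.mulAt h (j'.map s a) x')).comp (k'.map r)) (fun c d => ?_) c
    simp only [ContinuousLinearMap.comp_apply, innerSL_apply_apply, Morphism.map_mulAt, inner_mulAt,
      hj, ih]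

/-- The Gram matrix of the words is determined by the inner products of the letters. -/
theorem inner_eq
    (hii : ∀ t a a', (inner 𝕜 (i.map t a) (i.map t a') : 𝕜) = inner 𝕜 (i'.map t a) (i'.map t a'))
    (hij : ∀ t a b, (inner 𝕜 (i.map t a) (j.map t b) : 𝕜) = inner 𝕜 (i'.map t a) (j'.map t b))
    (hjj : ∀ t b b', (inner 𝕜 (j.map t b) (j.map t b') : 𝕜) = inner 𝕜 (j'.map t b) (j'.map t b'))
    {t : ℝ≥0} {x y : E t} {x' y' : E' t} (hx : JointProduct i j i' j' t x x')
    (hy : JointProduct i j i' j' t y y') : (inner 𝕜 x y : 𝕜) = inner 𝕜 x' y' := by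
  have hji (t b a) : (inner 𝕜 (j.map t b) (i.map t a) : 𝕜) =
      inner 𝕜 (j'.map t b) (i'.map t a) := by
    rw [← inner_conj_symm, hij, inner_conj_symm]
  have hl {t : ℝ≥0} {x : E t} {x' : E' t} (hx : JointProduct i j i' j' t x x') (a : A t) :
      (inner 𝕜 (i.map t a) x : 𝕜) = inner 𝕜 (i'.map t a) x' := by
    rw [← inner_conj_symm, inner_letter i i' hii hji hx, inner_conj_symm]
  have hr {t : ℝ≥0} {x : E t} {x' : E' t} (hx : JointProduct i j i' j' t x x') (b : B t) :
      (inner 𝕜 (j.map t b) x : 𝕜) = inner 𝕜 (j'.map t b) x' := by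
    rw [← inner_conj_symm, inner_letter j j' hij hjj hx, inner_conj_symm]
  induction hx with
  | one =>
    -- At time zero the empty word is the letter `1 ∈ A 0`, which also covers words `y` made of
    -- several letters of time zero.
    have := hl hy (A.scalar 1)
    rwa [i.map_scalar, i'.map_scalar] at this
  | @left s t r h a x x' hx ih =>
    -- Both inner products are continuous functionals of the pair formed by the second word. It
    -- suffices to compare them on pairs cut where the first letter ends.
    refine ContinuousLinearMap.eq_of_dense_span
      ((innerSL 𝕜 (E.mulAt h (i.map s a) x)).comp (ContinuousLinearMap.fst 𝕜 (E r) (E' r)))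
      ((innerSL 𝕜 (E'.mulAt h (i'.map s a) x')).comp (ContinuousLinearMap.snd 𝕜 (E r) (E' r)))
      ?_ (hy.mem_split h)
    rintro _ ⟨z, z', y, y', hz, hy, rfl⟩
    simp only [ContinuousLinearMap.comp_apply, innerSL_apply_apply, ContinuousLinearMap.coe_fst',
      ContinuousLinearMap.coe_snd', inner_mulAt, hl hz, ih hy]
  | @right s t r h b x x' hx ih =>
    refine ContinuousLinearMap.eq_of_dense_span
      ((innerSL 𝕜 (E.mulAt h (j.map s b) x)).comp (ContinuousLinearMap.fst 𝕜 (E r) (E' r)))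
      ((innerSL 𝕜 (E'.mulAt h (j'.map s b) x')).comp (ContinuousLinearMap.snd 𝕜 (E r) (E' r)))
      ?_ (hy.mem_split h)
    rintro _ ⟨z, z', y, y', hz, hy, rfl⟩
    simp only [ContinuousLinearMap.comp_apply, innerSL_apply_apply, ContinuousLinearMap.coe_fst',
      ContinuousLinearMap.coe_snd', inner_mulAt, hr hz, ih hy]

/-- If the words are total in `E`, and the letters have the same inner products in `E` and `E'`,
then replacing words by words is an isometric morphism. -/
theorem exists_morphism
    (hii : ∀ t a a', (inner 𝕜 (i.map t a) (i.map t a') : 𝕜) = inner 𝕜 (i'.map t a) (i'.map t a'))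
    (hij : ∀ t a b, (inner 𝕜 (i.map t a) (j.map t b) : 𝕜) = inner 𝕜 (i'.map t a) (j'.map t b))
    (hjj : ∀ t b b', (inner 𝕜 (j.map t b) (j.map t b') : 𝕜) = inner 𝕜 (j'.map t b) (j'.map t b'))
    (hd : ∀ t, Dense (Submodule.span 𝕜 {x | ∃ x', JointProduct i j i' j' t x x'} : Set (E t))) :
    ∃ U : E.Morphism E', U.IsIsometric ∧
      ∀ t x x', JointProduct i j i' j' t x x' → U.map t x = x' := by
  have hU (t : ℝ≥0) : ∃ U : E t →ₗᵢ[𝕜] E' t,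
      ∀ p : {p : E t × E' t // JointProduct i j i' j' t p.1 p.2}, U p.1.1 = p.1.2 := by
    refine exists_linearIsometry_of_inner_eq
      (fun p : {p : E t × E' t // JointProduct i j i' j' t p.1 p.2} => p.1.1) _ ?_
      (fun p q => inner_eq hii hij hjj p.2 q.2)
    convert hd t using 3
    ext x
    constructor
    · rintro ⟨p, rfl⟩
      exact ⟨_, p.2⟩
    · rintro ⟨x', hx⟩
      exact ⟨⟨(x, x'), hx⟩, rfl⟩
  choose U hU using hU
  have hU' (t x x') (hx : JointProduct i j i' j' t x x') : U t x = x' := hU t ⟨(x, x'), hx⟩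
  refine ⟨⟨fun t => (U t).toContinuousLinearMap, fun s t x y => ?_, fun b => ?_⟩,
    fun t => (U t).isometry, hU'⟩
  · let L : E s →L[𝕜] E t →L[𝕜] E' (s + t) :=
      (ContinuousLinearMap.compL 𝕜 _ _ _ (U (s + t)).toContinuousLinearMap).comp (E.mulAt rfl)
    let M : E s →L[𝕜] E t →L[𝕜] E' (s + t) :=
      (E'.mulAt rfl).bilinearComp (U s).toContinuousLinearMap (U t).toContinuousLinearMap
    -- Both sides are continuous and bilinear, so words suffice, and there the identity is
    -- concatenation.
    suffices L = M from congrArg (fun N : E s →L[𝕜] E t →L[𝕜] E' (s + t) => N x y) this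
    refine ContinuousLinearMap.ext fun x => L.eq_of_dense_span M ?_
      (Submodule.mem_topologicalClosure_of_dense (hd s) x)
    rintro x ⟨x', hx⟩
    refine ContinuousLinearMap.ext fun y => (L x).eq_of_dense_span (M x) ?_
      (Submodule.mem_topologicalClosure_of_dense (hd t) y)
    rintro y ⟨y', hy⟩
    change U (s + t) (E.mulAt rfl x y) = E'.mulAt rfl (U s x) (U t y)
    rw [hU' _ _ _ hx, hU' _ _ _ hy, hU' _ _ _ (hx.mul rfl hy)]
  · change U 0 (E.scalar b) = E'.scalar b
    rw [scalar_eq_smul, scalar_eq_smul b, map_smul, hU' _ _ _ one]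

end JointProduct

end ProductSystem

/-! ### Product subsystems. -/

namespace ProductSystem

variable {𝕜 : Type} [RCLike 𝕜]

theorem coe_timeCast {E : ProductSystem.{u} 𝕜} (K : ∀ t, Submodule 𝕜 (E t)) {s t : ℝ≥0} (h : s = t)
    (x : K s) : ((timeCast (𝕜 := 𝕜) (H := fun t => K t) h x : K t) : E t) =
      timeCast (𝕜 := 𝕜) (H := E) h (x : E s) := by
  subst h
  rfl

section Subsystem

variable (E : ProductSystem.{u} 𝕜) (K : ∀ t, Submodule 𝕜 (E t))
  (hmul : ∀ (s t : ℝ≥0) (x : E s) (y : E t), x ∈ K s → y ∈ K t → E.mul s t (x ⊗ₜ y) ∈ K (s + t))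

/-- The restriction of the multiplication to a multiplicative family of subspaces. -/
noncomputable def subsystemMul (s t : ℝ≥0) : K s ⊗[𝕜] K t →ₗᵢ[𝕜] K (s + t) where
  toLinearMap := LinearMap.codRestrict (K (s + t)) ((E.mul s t).toLinearMap.comp
    (TensorProduct.mapIsometry (K s).subtypeₗᵢ (K t).subtypeₗᵢ).toLinearMap) fun z => by
      induction z with
      | zero => rw [map_zero]; exact zero_mem _
      | add x y hx hy => rw [map_add]; exact add_mem hx hy
      | tmul x y => exact hmul s t x y x.2 y.2
  norm_map' z := ((E.mul s t).norm_map _).trans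
    ((TensorProduct.mapIsometry (K s).subtypeₗᵢ (K t).subtypeₗᵢ).norm_map z)

/-- The product system formed by closed subspaces that are closed under multiplication and
spanned by products. -/
noncomputable def subsystem (hK : ∀ t, IsClosed (K t : Set (E t))) (hone : E.scalar 1 ∈ K 0)
    (hdense : ∀ s t, K (s + t) ≤ (Submodule.span 𝕜
      {z | ∃ x ∈ K s, ∃ y ∈ K t, E.mul s t (x ⊗ₜ y) = z}).topologicalClosure) :
    ProductSystem.{u} 𝕜 where
  space t := K t
  complete t := (hK t).completeSpace_coe
  mul := subsystemMul E K hmul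
  denseRange_mul s t := by
    have hle : Submodule.span 𝕜 {z | ∃ x ∈ K s, ∃ y ∈ K t, E.mul s t (x ⊗ₜ y) = z} ≤
        (LinearMap.range (subsystemMul E K hmul s t).toLinearMap).map (K (s + t)).subtype := by
      rw [Submodule.span_le]
      rintro _ ⟨x, hx, y, hy, rfl⟩
      exact ⟨_, ⟨(⟨x, hx⟩ : K s) ⊗ₜ (⟨y, hy⟩ : K t), rfl⟩, rfl⟩
    refine Subtype.dense_iff.2 fun z hz => closure_mono ?_ (hdense s t hz)
    intro z hz
    obtain ⟨_, ⟨p, rfl⟩, rfl⟩ := hle hz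
    exact ⟨_, ⟨p, rfl⟩, rfl⟩
  -- `E 0` is one-dimensional, so `K 0`, which contains the image of `1`, is all of it.
  scalar := LinearIsometryEquiv.ofSurjective
    { toLinearMap := E.scalar.toLinearEquiv.toLinearMap.codRestrict (K 0) fun b => by
        change E.scalar b ∈ K 0
        rw [scalar_eq_smul]
        exact (K 0).smul_mem b hone
      norm_map' := fun b => E.scalar.norm_map b } fun x => by
        obtain ⟨b, hb⟩ := E.scalar.surjective x
        exact ⟨b, Subtype.ext hb⟩
  mul_assoc r s t x y z := Subtype.ext <| by
    rw [coe_timeCast]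
    exact E.mul_assoc r s t x y z
  mul_scalar s x b := Subtype.ext <| by
    rw [coe_timeCast]
    exact E.mul_scalar s x b
  scalar_mul t b x := Subtype.ext <| by
    rw [coe_timeCast]
    exact E.scalar_mul t b x

end Subsystem

end ProductSystem

/-! ### Embeddings into the tensor product and the words they generate. -/

namespace SpatialProductSystem

open ProductSystem

variable {𝕜 : Type} [RCLike 𝕜] (A : SpatialProductSystem.{u} 𝕜) (B : SpatialProductSystem.{v} 𝕜)

theorem norm_ref (t : ℝ≥0) : ‖A.ref.val t‖ = 1 := by
  rw [@norm_eq_sqrt_re_inner 𝕜, A.inner_ref]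
  simp

theorem inner_tmul {A : ProductSystem.{u} 𝕜} {B : ProductSystem.{v} 𝕜} {t : ℝ≥0} (a a' : A t)
    (b b' : B t) : (inner 𝕜 (tmul A B a b) (tmul A B a' b') : 𝕜) =
      inner 𝕜 a a' * inner 𝕜 b b' :=
  (Completion.inner_coe _ _).trans (TensorProduct.inner_tmul _ _ _ _ _)

theorem norm_tmul {A : ProductSystem.{u} 𝕜} {B : ProductSystem.{v} 𝕜} {t : ℝ≥0} (a : A t)
    (b : B t) : ‖tmul A B a b‖ = ‖a‖ * ‖b‖ :=
  (Completion.norm_coe _).trans (TensorProduct.norm_tmul _ _)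

/-- The elementary tensors as a continuous bilinear map. -/
noncomputable def tmulL (A : ProductSystem.{u} 𝕜) (B : ProductSystem.{v} 𝕜) (t : ℝ≥0) :
    A t →L[𝕜] B t →L[𝕜] (A.tensor B) t :=
  LinearMap.mkContinuous₂ ((TensorProduct.mk 𝕜 (A t) (B t)).compr₂
    (Completion.toComplₗᵢ (𝕜 := 𝕜) (E := A t ⊗[𝕜] B t)).toLinearMap) 1 fun a b => by
      rw [one_mul]
      exact (norm_tmul a b).le

theorem tmulL_apply {A : ProductSystem.{u} 𝕜} {B : ProductSystem.{v} 𝕜} {t : ℝ≥0} (a : A t)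
    (b : B t) : tmulL A B t a b = tmul A B a b := rfl

theorem mulAt_tmul {A : ProductSystem.{u} 𝕜} {B : ProductSystem.{v} 𝕜} {s t r : ℝ≥0}
    (h : s + t = r) (a : A s) (b : B s) (a' : A t) (b' : B t) :
    (A.tensor B).mulAt h (tmul A B a b) (tmul A B a' b') =
      tmul A B (A.mulAt h a a') (B.mulAt h b b') := by
  subst h
  exact tensorMul_tmul A B s t a b a' b'

theorem tensor_scalar {A : ProductSystem.{u} 𝕜} {B : ProductSystem.{v} 𝕜} (b : 𝕜) :
    (A.tensor B).scalar b = tmul A B (A.scalar 1) (B.scalar b) := rfl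

/-- The embedding `a ↦ a ⊗ ω` into the tensor product. -/
noncomputable def inlTensor : A.Morphism (A.toProductSystem.tensor B.toProductSystem) where
  map t := (tmulL A.toProductSystem B.toProductSystem t).flip (B.ref.val t)
  map_mul s t x y := by
    simp only [ContinuousLinearMap.flip_apply, tmulL_apply, ← mulAt_rfl, mulAt_tmul,
      B.ref.mulAt_val]
  map_scalar b := by
    rw [ContinuousLinearMap.flip_apply, B.ref.val_zero, tensor_scalar, scalar_eq_smul,
      scalar_eq_smul b, ← tmulL_apply, map_smul, map_smul,
      smul_apply]

/-- The embedding `b ↦ ω ⊗ b` into the tensor product. -/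
noncomputable def inrTensor : B.Morphism (A.toProductSystem.tensor B.toProductSystem) where
  map t := tmulL A.toProductSystem B.toProductSystem t (A.ref.val t)
  map_mul s t x y := by
    simp only [tmulL_apply, ← mulAt_rfl, mulAt_tmul, A.ref.mulAt_val]
  map_scalar b := by
    rw [A.ref.val_zero, tensor_scalar, tmulL_apply]

variable {A B}

theorem inlTensor_map (t : ℝ≥0) (a : A.space t) : (inlTensor A B).map t a =
    tmul A.toProductSystem B.toProductSystem a (B.ref.val t) := rfl

theorem inrTensor_map (t : ℝ≥0) (b : B.space t) : (inrTensor A B).map t b =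
    tmul A.toProductSystem B.toProductSystem (A.ref.val t) b := rfl

/-- Each embedded letter is `x.fst ⊗ x.snd`, so the replacement map is nothing but evaluation of
words in the tensor product. -/
theorem prod_embed_tensor (l : List (Letter A B)) :
    (A.toProductSystem.tensor B.toProductSystem).prod Letter.time
      (Letter.embed (inlTensor A B) (inrTensor A B)) l =
    tmul A.toProductSystem B.toProductSystem (A.prod Letter.time Letter.fst l)
      (B.prod Letter.time Letter.snd l) := by
  induction l with
  | nil => rfl
  | cons x l ih =>
    have : Letter.embed (inlTensor A B) (inrTensor A B) x =
        tmul A.toProductSystem B.toProductSystem x.fst x.snd := by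
      rcases x with ⟨t, a | b⟩ <;> rfl
    rw [ProductSystem.prod, ih, this, ← mulAt_rfl, mulAt_tmul]
    rfl

universe w'

variable {E : ProductSystem.{w} 𝕜} {E' : ProductSystem.{w'} 𝕜}

theorem jointProduct_prod (i : A.Morphism E) (j : B.Morphism E) (i' : A.Morphism E')
    (j' : B.Morphism E') (l : List (Letter A B)) {t : ℝ≥0} (h : totalTime Letter.time l = t) :
    JointProduct i j i' j' t
      (timeCast (𝕜 := 𝕜) (H := E) h (E.prod Letter.time (Letter.embed i j) l))
      (timeCast (𝕜 := 𝕜) (H := E') h (E'.prod Letter.time (Letter.embed i' j') l)) := by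
  subst h
  induction l with
  | nil => exact .one
  | cons x l ih =>
    rcases x with ⟨t, a | b⟩
    · exact .left rfl a ih
    · exact .right rfl b ih

theorem exists_prod_of_jointProduct {i : A.Morphism E} {j : B.Morphism E} {i' : A.Morphism E'}
    {j' : B.Morphism E'} {t : ℝ≥0} {x : E t} {x' : E' t} (hx : JointProduct i j i' j' t x x') :
    ∃ (l : List (Letter A B)) (h : totalTime Letter.time l = t),
      timeCast (𝕜 := 𝕜) (H := E) h (E.prod Letter.time (Letter.embed i j) l) = x ∧
      timeCast (𝕜 := 𝕜) (H := E') h (E'.prod Letter.time (Letter.embed i' j') l) = x' := by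
  induction hx with
  | one => exact ⟨[], rfl, rfl, rfl⟩
  | left h a hx ih =>
    obtain ⟨l, rfl, rfl, rfl⟩ := ih
    exact ⟨⟨_, Sum.inl a⟩ :: l, h, rfl, rfl⟩
  | right h b hx ih =>
    obtain ⟨l, rfl, rfl, rfl⟩ := ih
    exact ⟨⟨_, Sum.inr b⟩ :: l, h, rfl, rfl⟩

/-- Every word also has a value in the second system, so forgetting that value loses nothing. When
only one system matters, `E' = E` serves. -/
theorem prodsAt_eq_jointProduct (i : A.Morphism E) (j : B.Morphism E) (i' : A.Morphism E')
    (j' : B.Morphism E') (t : ℝ≥0) : E.prodsAt Letter.time (Letter.embed i j) t =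
      {x | ∃ x', JointProduct i j i' j' t x x'} := by
  ext x
  constructor
  · rintro ⟨l, h, rfl⟩
    exact ⟨_, jointProduct_prod i j i' j' l h⟩
  · rintro ⟨x', hx⟩
    obtain ⟨l, h, rfl, -⟩ := exists_prod_of_jointProduct hx
    exact ⟨l, h, rfl⟩

theorem mul_mem_closure_prodsAt (i : A.Morphism E) (j : B.Morphism E) {s t r : ℝ≥0} (h : s + t = r)
    {x : E s} {y : E t}
    (hx : x ∈ (Submodule.span 𝕜
      (E.prodsAt Letter.time (Letter.embed i j) s)).topologicalClosure)
    (hy : y ∈ (Submodule.span 𝕜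
      (E.prodsAt Letter.time (Letter.embed i j) t)).topologicalClosure) :
    E.mulAt h x y ∈ (Submodule.span 𝕜
      (E.prodsAt Letter.time (Letter.embed i j) r)).topologicalClosure := by
  refine (E.mulAt h x).map_mem_of_dense_span (Submodule.isClosed_topologicalClosure _) ?_ hy
  intro y hy
  refine ((E.mulAt h).flip y).map_mem_of_dense_span (Submodule.isClosed_topologicalClosure _) ?_ hx
  intro x hx
  rw [prodsAt_eq_jointProduct i j i j] at hx hy ⊢
  obtain ⟨x', hx⟩ := hx
  obtain ⟨y', hy⟩ := hy
  exact Submodule.le_topologicalClosure _ (Submodule.subset_span ⟨_, hx.mul h hy⟩)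

/-- This is the cutting of words, projected to one coordinate. It makes the closed spans of words a
product system rather than just a multiplicative family. -/
theorem closure_prodsAt_le (i : A.Morphism E) (j : B.Morphism E) (s t : ℝ≥0) :
    (Submodule.span 𝕜
      (E.prodsAt Letter.time (Letter.embed i j) (s + t))).topologicalClosure ≤
    (Submodule.span 𝕜 {z | ∃ x ∈ (Submodule.span 𝕜
        (E.prodsAt Letter.time (Letter.embed i j) s)).topologicalClosure,
      ∃ y ∈ (Submodule.span 𝕜
        (E.prodsAt Letter.time (Letter.embed i j) t)).topologicalClosure,
      E.mul s t (x ⊗ₜ y) = z}).topologicalClosure := by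
  refine Submodule.topologicalClosure_minimal _ ?_ (Submodule.isClosed_topologicalClosure _)
  rw [Submodule.span_le]
  intro z hz
  rw [prodsAt_eq_jointProduct i j i j] at hz
  obtain ⟨z', hz⟩ := hz
  refine (ContinuousLinearMap.fst 𝕜 (E (s + t)) (E (s + t))).map_mem_of_dense_span
    (Submodule.isClosed_topologicalClosure _) ?_ (hz.mem_split rfl)
  rintro _ ⟨x, x', y, y', hx, hy, rfl⟩
  refine Submodule.le_topologicalClosure _ (Submodule.subset_span
    ⟨x, Submodule.le_topologicalClosure _ (Submodule.subset_span ?_),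
      y, Submodule.le_topologicalClosure _ (Submodule.subset_span ?_), rfl⟩)
  · rw [prodsAt_eq_jointProduct i j i j]
    exact ⟨_, hx⟩
  · rw [prodsAt_eq_jointProduct i j i j]
    exact ⟨_, hy⟩

theorem map_mem_closure_prodsAt_left (i : A.Morphism E) (j : B.Morphism E) (t : ℝ≥0)
    (a : A.space t) : i.map t a ∈ (Submodule.span 𝕜
      (E.prodsAt Letter.time (Letter.embed i j) t)).topologicalClosure := by
  rw [prodsAt_eq_jointProduct i j i j]
  exact Submodule.le_topologicalClosure _ (Submodule.subset_span ⟨_, .map_left t a⟩)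

theorem map_mem_closure_prodsAt_right (i : A.Morphism E) (j : B.Morphism E) (t : ℝ≥0)
    (b : B.space t) : j.map t b ∈ (Submodule.span 𝕜
      (E.prodsAt Letter.time (Letter.embed i j) t)).topologicalClosure := by
  rw [prodsAt_eq_jointProduct i j i j]
  exact Submodule.le_topologicalClosure _ (Submodule.subset_span ⟨_, .map_right t b⟩)

/-! ### Existence of a product. -/

variable (A B) in
/-- The subsystem of the tensor product generated by `A ⊗ ω` and `ω ⊗ B`. -/
noncomputable def productSubsystem : ProductSystem.{max u v} 𝕜 :=
  (A.toProductSystem.tensor B.toProductSystem).subsystem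
    (fun t => (Submodule.span 𝕜 ((A.toProductSystem.tensor B.toProductSystem).prodsAt
      Letter.time (Letter.embed (inlTensor A B) (inrTensor A B)) t)).topologicalClosure)
    (fun _ _ _ _ hx hy => mul_mem_closure_prodsAt _ _ rfl hx hy)
    (fun _ => Submodule.isClosed_topologicalClosure _)
    (Submodule.le_topologicalClosure _ (Submodule.subset_span ⟨[], rfl, rfl⟩))
    (closure_prodsAt_le _ _)

variable (A B) in
/-- The product of two spatial product systems. -/
noncomputable def product : SpatialProductSystem.{max u v} 𝕜 where
  toProductSystem := productSubsystem A B
  ref :=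
    { val := fun t => ⟨(inlTensor A B).map t (A.ref.val t), map_mem_closure_prodsAt_left _ _ _ _⟩
      mul_val := fun s t => Subtype.ext <|
        ((inlTensor A B).map_mul s t _ _).symm.trans (by rw [A.ref.mul_val])
      val_zero := Subtype.ext <| by
        rw [A.ref.val_zero]
        exact (inlTensor A B).map_scalar 1 }
  inner_ref t := by
    refine (inner_tmul (A := A.toProductSystem) (B := B.toProductSystem) _ _ _ _).trans ?_
    rw [A.inner_ref, B.inner_ref, one_mul]

variable (A B) in
noncomputable def inlProduct : A.Morphism (product A B).toProductSystem where
  map t := ((inlTensor A B).map t).codRestrict _ (map_mem_closure_prodsAt_left _ _ t)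
  map_mul s t x y := Subtype.ext ((inlTensor A B).map_mul s t x y)
  map_scalar b := Subtype.ext ((inlTensor A B).map_scalar b)

variable (A B) in
noncomputable def inrProduct : B.Morphism (product A B).toProductSystem where
  map t := ((inrTensor A B).map t).codRestrict _ (map_mem_closure_prodsAt_right _ _ t)
  map_mul s t x y := Subtype.ext ((inrTensor A B).map_mul s t x y)
  map_scalar b := Subtype.ext ((inrTensor A B).map_scalar b)

theorem norm_inlTensor (t : ℝ≥0) (a : A.space t) : ‖(inlTensor A B).map t a‖ = ‖a‖ := by
  rw [inlTensor_map, norm_tmul, norm_ref, mul_one]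

theorem norm_inrTensor (t : ℝ≥0) (b : B.space t) : ‖(inrTensor A B).map t b‖ = ‖b‖ := by
  rw [inrTensor_map, norm_tmul, norm_ref, one_mul]

theorem isIsometric_inlTensor : (inlTensor A B).IsIsometric := fun t =>
  AddMonoidHomClass.isometry_of_norm _ (norm_inlTensor t)

theorem isIsometric_inrTensor : (inrTensor A B).IsIsometric := fun t =>
  AddMonoidHomClass.isometry_of_norm _ (norm_inrTensor t)

theorem inner_inlTensor_inrTensor (t : ℝ≥0) (a : A.space t) (b : B.space t) :
    (inner 𝕜 ((inlTensor A B).map t a) ((inrTensor A B).map t b) : 𝕜) =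
      inner 𝕜 a (A.ref.val t) * inner 𝕜 (B.ref.val t) b :=
  inner_tmul (A := A.toProductSystem) (B := B.toProductSystem) _ _ _ _

variable (A B) in
/-- The inclusion of the product into the tensor product. -/
noncomputable def productVal (t : ℝ≥0) : (product A B).space t →ₗᵢ[𝕜]
    (A.toProductSystem.tensor B.toProductSystem) t :=
  (Submodule.span 𝕜 ((A.toProductSystem.tensor B.toProductSystem).prodsAt
    Letter.time (Letter.embed (inlTensor A B) (inrTensor A B)) t)).topologicalClosure.subtypeₗᵢ

theorem productVal_mem (t : ℝ≥0) (x : (product A B).space t) : productVal A B t x ∈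
    (Submodule.span 𝕜 ((A.toProductSystem.tensor B.toProductSystem).prodsAt
      Letter.time (Letter.embed (inlTensor A B) (inrTensor A B)) t)).topologicalClosure :=
  x.2

theorem productVal_mul (s t : ℝ≥0) (x : (product A B).space s) (y : (product A B).space t) :
    productVal A B (s + t) ((product A B).mul s t (x ⊗ₜ y)) =
      (A.toProductSystem.tensor B.toProductSystem).mul s t
        (productVal A B s x ⊗ₜ productVal A B t y) := rfl

theorem productVal_prod (l : List (Letter A B)) :
    productVal A B _ ((product A B).prod Letter.time
      (Letter.embed (inlProduct A B) (inrProduct A B)) l) =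
      (A.toProductSystem.tensor B.toProductSystem).prod Letter.time
        (Letter.embed (inlTensor A B) (inrTensor A B)) l := by
  induction l with
  | nil => rfl
  | cons x l ih =>
    have : productVal A B _ (Letter.embed (inlProduct A B) (inrProduct A B) x) =
        Letter.embed (inlTensor A B) (inrTensor A B) x := by
      rcases x with ⟨t, a | b⟩ <;> rfl
    refine (productVal_mul _ _ _ _).trans ?_
    rw [ih, this]
    rfl

theorem isProduct_product : IsProduct A B (product A B) (inlProduct A B) (inrProduct A B) where
  isometric_left t := AddMonoidHomClass.isometry_of_norm _ (norm_inlTensor t)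
  isometric_right t := AddMonoidHomClass.isometry_of_norm _ (norm_inrTensor t)
  map_ref_left t := rfl
  map_ref_right t := rfl
  inner_map_map := inner_inlTensor_inrTensor
  dense_span t := by
    intro z
    have hle : Submodule.span 𝕜 ((A.toProductSystem.tensor B.toProductSystem).prodsAt
        Letter.time (Letter.embed (inlTensor A B) (inrTensor A B)) t) ≤
        (Submodule.span 𝕜 ((product A B).prodsAt Letter.time
          (Letter.embed (inlProduct A B) (inrProduct A B)) t)).map
            (productVal A B t).toLinearMap := by
      rw [Submodule.span_le]
      rintro _ ⟨l, rfl, rfl⟩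
      exact ⟨_, Submodule.subset_span ⟨l, rfl, rfl⟩, productVal_prod l⟩
    -- Density in the subspace is tested after inclusion in the tensor product, where the words span
    -- the subspace densely by its definition.
    rw [(productVal A B t).isometry.isEmbedding.isInducing.closure_eq_preimage_closure_image]
    exact closure_mono hle (productVal_mem t z)

/-! ### The isometric morphism from a product to the tensor product. -/

section Universal

variable {F : SpatialProductSystem.{w} 𝕜} {i : A.Morphism F.toProductSystem}
  {j : B.Morphism F.toProductSystem}

theorem IsProduct.morphism_ext (hF : IsProduct A B F i j)
    {U V : F.Morphism (A.toProductSystem.tensor B.toProductSystem)}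
    (hU : ExtendsReplacement i j U) (hV : ExtendsReplacement i j V) : U = V := by
  refine Morphism.ext fun t x => (U.map t).eq_of_dense_span (V.map t) ?_
    (Submodule.mem_topologicalClosure_of_dense (hF.dense_span t) x)
  rintro _ ⟨l, rfl, rfl⟩
  exact (hU l).trans (hV l).symm

theorem IsProduct.exists_morphism (hF : IsProduct A B F i j) :
    ∃ U : F.Morphism (A.toProductSystem.tensor B.toProductSystem),
      ExtendsReplacement i j U ∧ U.IsIsometric := by
  obtain ⟨U, hU, hUx⟩ := JointProduct.exists_morphism (i := i) (j := j) (i' := inlTensor A B)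
    (j' := inrTensor A B)
    (fun t a a' => by rw [hF.isometric_left.inner_map, isIsometric_inlTensor.inner_map])
    (fun t a b => by rw [hF.inner_map_map, inner_inlTensor_inrTensor])
    (fun t b b' => by rw [hF.isometric_right.inner_map, isIsometric_inrTensor.inner_map])
    (fun t => by rw [← prodsAt_eq_jointProduct]; exact hF.dense_span t)
  refine ⟨U, fun l => ?_, hU⟩
  rw [← prod_embed_tensor]
  exact hUx _ _ _ (jointProduct_prod i j (inlTensor A B) (inrTensor A B) l rfl)

/-- A single letter is the value of a word. This and `map_right` place the generators `a ⊗ ω` and `ω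
⊗ b` in the range of `U`. -/
theorem ExtendsReplacement.map_left {U : F.Morphism (A.toProductSystem.tensor B.toProductSystem)}
    (hU : ExtendsReplacement i j U) (t : ℝ≥0) (a : A.space t) :
    U.map t (i.map t a) = (inlTensor A B).map t a := by
  obtain ⟨l, h, h₁, h₂⟩ := exists_prod_of_jointProduct
    (JointProduct.map_left (i := i) (j := j) (i' := inlTensor A B) (j' := inrTensor A B) t a)
  rw [← h₁, ← h₂, Morphism.map_timeCast, hU l, prod_embed_tensor]

theorem ExtendsReplacement.map_right {U : F.Morphism (A.toProductSystem.tensor B.toProductSystem)}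
    (hU : ExtendsReplacement i j U) (t : ℝ≥0) (b : B.space t) :
    U.map t (j.map t b) = (inrTensor A B).map t b := by
  obtain ⟨l, h, h₁, h₂⟩ := exists_prod_of_jointProduct
    (JointProduct.map_right (i := i) (j := j) (i' := inlTensor A B) (j' := inrTensor A B) t b)
  rw [← h₁, ← h₂, Morphism.map_timeCast, hU l, prod_embed_tensor]

end Universal

end SpatialProductSystem

/-! ### Multiplicative functions on the half-line. -/

section Semigroups

open Filter Topology

/-- With truncated subtraction `φ s * φ (t - s) = φ (max s t) = φ t * φ (s - t)`, which treats both
sides of `t` at once. Near `t` the factor `φ (t - s)` is nonzero and can be divided out. -/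
theorem continuous_of_tendsto_one_of_map_add {φ : ℝ≥0 → ℂ}
    (hm : ∀ s t, φ (s + t) = φ s * φ t) (h : Tendsto φ (𝓝 0) (𝓝 1)) : Continuous φ := by
  rw [continuous_iff_continuousAt]
  intro t
  have h₁ : Tendsto (fun s => φ (s - t)) (𝓝 t) (𝓝 1) :=
    h.comp ((show Continuous fun s : ℝ≥0 => s - t by fun_prop).tendsto' _ _ (tsub_self t))
  have h₂ : Tendsto (fun s => φ (t - s)) (𝓝 t) (𝓝 1) :=
    h.comp ((show Continuous fun s : ℝ≥0 => t - s by fun_prop).tendsto' _ _ (tsub_self t))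
  have h₃ : Tendsto (fun s => φ t * φ (s - t) / φ (t - s)) (𝓝 t) (𝓝 (φ t)) := by
    have h := (h₁.const_mul (φ t)).div h₂ one_ne_zero
    rw [mul_one, div_one] at h
    exact h
  refine h₃.congr' ?_
  filter_upwards [h₂.eventually_ne one_ne_zero] with s hs
  rw [div_eq_iff hs, ← hm, ← hm, add_tsub_eq_max, add_tsub_eq_max, max_comm]

theorem map_natCast_mul_of_map_add {M : Type*} [Monoid M] {φ : ℝ≥0 → M} (h0 : φ 0 = 1)
    (hm : ∀ s t, φ (s + t) = φ s * φ t) (n : ℕ) (t : ℝ≥0) : φ (n * t) = φ t ^ n := by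
  induction n with
  | zero => simp [h0]
  | succ n ih => rw [Nat.cast_succ, add_mul, one_mul, hm, ih, pow_succ]

/-- Such a function is antitone. If it stayed below some `c < 1` at all `1 / n`, then `ρ 1 ≤ c ^ n`
for all `n ≥ 1` would contradict positivity. -/
theorem tendsto_one_of_map_add {ρ : ℝ≥0 → ℝ} (h0 : ρ 0 = 1) (hm : ∀ s t, ρ (s + t) = ρ s * ρ t)
    (hpos : ∀ t, 0 < ρ t) (hle : ∀ t, ρ t ≤ 1) : Tendsto ρ (𝓝 0) (𝓝 1) := by
  have hanti : Antitone ρ := by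
    intro s t hst
    obtain ⟨d, rfl⟩ := exists_add_of_le hst
    rw [hm]
    exact mul_le_of_le_one_right (hpos s).le (hle d)
  refine tendsto_order.2 ⟨fun c hc => ?_, fun c hc => Eventually.of_forall fun t =>
    (hle t).trans_lt hc⟩
  obtain ⟨n, hn0, hn⟩ : ∃ n : ℕ, n ≠ 0 ∧ c < ρ ((n : ℝ≥0)⁻¹) := by
    by_contra! hcon
    have hpow (n : ℕ) (hn : n ≠ 0) : ρ 1 ≤ c ^ n := by
      have := map_natCast_mul_of_map_add h0 hm n (n : ℝ≥0)⁻¹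
      rw [mul_inv_cancel₀ (Nat.cast_ne_zero.2 hn)] at this
      rw [this]
      exact pow_le_pow_left₀ (hpos _).le (hcon n hn) n
    have hc0 : 0 ≤ c := by simpa using (hpos 1).le.trans (hpow 1 one_ne_zero)
    refine (hpos 1).not_ge (ge_of_tendsto (tendsto_pow_atTop_nhds_zero_of_lt_one hc0 hc) ?_)
    filter_upwards [eventually_ne_atTop 0] with n hn using hpow n hn
  have hpos' : (0 : ℝ≥0) < (n : ℝ≥0)⁻¹ := by positivity
  filter_upwards [Iio_mem_nhds hpos'] with t ht using hn.trans_le (hanti (le_of_lt ht))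

/-- Continuous one-parameter semigroups of complex numbers are exponential. -/
theorem exists_eq_exp_of_map_add {φ : ℝ≥0 → ℂ} (hc : Continuous φ) (h0 : φ 0 = 1)
    (hm : ∀ s t, φ (s + t) = φ s * φ t) : ∃ c : ℂ, ∀ t : ℝ≥0, φ t = Complex.exp (c * (t : ℝ)) := by
  set g : ℝ → ℂ := fun x => φ x.toNNReal with hg
  have hgc : Continuous g := hc.comp continuous_real_toNNReal
  have hg0 : g 0 = 1 := by simp [hg, h0]
  have hgm {x y : ℝ} (hx : 0 ≤ x) (hy : 0 ≤ y) : g (x + y) = g x * g y := by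
    simp only [hg, Real.toNNReal_add hx hy, hm]
  set G : ℝ → ℂ := fun x => ∫ y in (0 : ℝ)..x, g y with hG
  have hGd (x : ℝ) : HasDerivAt G (g x) x := (hgc.integral_hasStrictDerivAt 0 x).hasDerivAt
  obtain ⟨h, hGh, hh⟩ : ∃ h, G h ≠ 0 ∧ 0 < h := by
    have h1 : ∀ᶠ z in 𝓝[≠] (0 : ℝ), G z ≠ 0 :=
      (hGd 0).eventually_ne (by rw [hg0]; exact one_ne_zero)
    have h2 : ∀ᶠ z in 𝓝[>] (0 : ℝ), G z ≠ 0 := h1.filter_mono (nhdsGT_le_nhdsNE 0)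
    exact (h2.and self_mem_nhdsWithin).exists
  have hshift {x : ℝ} (hx : 0 ≤ x) : G (x + h) - G x = g x * G h := by
    have h1 : G (x + h) - G x = ∫ y in x..(x + h), g y :=
      intervalIntegral.integral_interval_sub_left (hgc.intervalIntegrable _ _)
        (hgc.intervalIntegrable _ _)
    have h2 : ∫ y in (0 : ℝ)..h, g (y + x) = ∫ y in x..(x + h), g y := by
      rw [intervalIntegral.integral_comp_add_right, zero_add, add_comm h]
    rw [h1, ← h2, hG, ← intervalIntegral.integral_const_mul]
    refine intervalIntegral.integral_congr fun y hy => ?_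
    rw [Set.uIcc_of_le hh.le] at hy
    simp only [hgm hy.1 hx, mul_comm]
  set c : ℂ := (g h - 1) / G h with hcdef
  -- For `x ≥ 0` this is `g x * exp (-c * x)`. Writing `g` through its primitive makes
  -- differentiability evident, also from both sides at `0`, and `c` is chosen so that the
  -- derivative vanishes.
  set k : ℝ → ℂ := fun x => (G (x + h) - G x) / G h * Complex.exp (-c * x) with hk
  have hkg {x : ℝ} (hx : 0 ≤ x) : k x = g x * Complex.exp (-c * x) := by
    simp only [hk, hshift hx]
    rw [mul_div_cancel_right₀ _ hGh]
  have hexp (x : ℝ) : HasDerivAt (fun x : ℝ => Complex.exp (-c * x))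
      (Complex.exp (-c * x) * (-c)) x := by
    have := ((hasDerivAt_id (x : ℂ)).const_mul (-c)).cexp.comp_ofReal
    simpa using this
  have hkd {x : ℝ} (hx : 0 ≤ x) : HasDerivAt k 0 x := by
    have h1 := ((((hGd (x + h)).comp_add_const x h).fun_sub (hGd x)).div_const (G h)).fun_mul
      (hexp x)
    refine h1.congr_deriv ?_
    simp only [hshift hx, hgm hx hh.le, hcdef]
    field_simp
    ring
  refine ⟨c, fun t => ?_⟩
  have hcont : ContinuousOn k (Set.Icc 0 (t : ℝ)) := fun x hx =>
    (hkd hx.1).continuousAt.continuousWithinAt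
  have hconst := constant_of_has_deriv_right_zero hcont
    (fun x hx => (hkd hx.1).hasDerivWithinAt) (t : ℝ) ⟨t.coe_nonneg, le_rfl⟩
  rw [hkg t.coe_nonneg, hkg le_rfl, hg0] at hconst
  have hgt : g t = φ t := by simp [hg]
  rw [hgt] at hconst
  simp only [Complex.ofReal_zero, mul_zero, Complex.exp_zero, mul_one, neg_mul,
    Complex.exp_neg] at hconst
  rwa [← div_eq_mul_inv, div_eq_one_iff_eq (Complex.exp_ne_zero _)] at hconst

/-- The limit depends only on the first-order behaviour of `P` at `0`; this drives the Trotter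
argument. -/
theorem tendsto_pow_of_hasDerivAt {P : ℝ → ℂ} {α : ℂ} (h0 : P 0 = 1) (hP : HasDerivAt P α 0)
    (t : ℝ) : Tendsto (fun n : ℕ => P (t / n) ^ n) atTop (𝓝 (Complex.exp (t * α))) := by
  have h1 : HasDerivAt (fun x : ℝ => P (t * x)) (t * α) 0 := by
    have h2 : HasDerivAt (fun x : ℝ => t * x) t 0 := by
      simpa using (hasDerivAt_id (0 : ℝ)).const_mul t
    have hP' : HasDerivAt P α (t * 0) := by rwa [mul_zero]
    have h3 := hP'.scomp (0 : ℝ) h2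
    rw [Complex.real_smul] at h3
    exact h3
  have h2 := hasDerivAt_iff_tendsto_slope_zero.1 h1
  have h3 : Tendsto (fun n : ℕ => (n : ℝ)⁻¹) atTop (𝓝[≠] 0) := by
    refine tendsto_nhdsWithin_iff.2 ⟨tendsto_inv_atTop_nhds_zero_nat, ?_⟩
    filter_upwards [eventually_ne_atTop 0] with n hn
    simpa using hn
  have h4 := h2.comp h3
  have h5 := Complex.tendsto_one_add_pow_exp_of_tendsto (g := fun n : ℕ => P (t / n) - 1)
    (t := t * α) (h4.congr fun n => by simp [h0, div_eq_mul_inv])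
  simpa using h5

end Semigroups

/-! ### Units and a Trotter formula. -/

namespace ProductSystem

open Filter Topology

theorem Unit.inner_add {𝕜 : Type} [RCLike 𝕜] {E : ProductSystem.{u} 𝕜} (ξ η : E.Unit) (s t : ℝ≥0) :
    (inner 𝕜 (ξ.val (s + t)) (η.val (s + t)) : 𝕜) =
      inner 𝕜 (ξ.val s) (η.val s) * inner 𝕜 (ξ.val t) (η.val t) := by
  rw [← ξ.mulAt_val rfl, ← η.mulAt_val rfl, inner_mulAt]

theorem Unit.inner_zero {𝕜 : Type} [RCLike 𝕜] {E : ProductSystem.{u} 𝕜} (ξ η : E.Unit) :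
    (inner 𝕜 (ξ.val 0) (η.val 0) : 𝕜) = 1 := by
  rw [ξ.val_zero, η.val_zero, inner_scalar_one]

/-- The product of a unit with a character of the half-line. -/
def Unit.smul {𝕜 : Type} [RCLike 𝕜] {E : ProductSystem.{u} 𝕜} (ξ : E.Unit) (χ : ℝ≥0 → 𝕜)
    (h0 : χ 0 = 1) (hm : ∀ s t, χ (s + t) = χ s * χ t) : E.Unit where
  val t := χ t • ξ.val t
  mul_val s t := by
    rw [← mulAt_rfl, map_smul, map_smul, smul_apply, ξ.mulAt_val, smul_smul, hm, mul_comm]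
  val_zero := by rw [h0, one_smul, ξ.val_zero]

/-- The tensor product of two units. -/
noncomputable def Unit.tensor {𝕜 : Type} [RCLike 𝕜] {A : ProductSystem.{u} 𝕜}
    {B : ProductSystem.{v} 𝕜} (ξ : A.Unit) (η : B.Unit) : (A.tensor B).Unit where
  val t := tmul A B (ξ.val t) (η.val t)
  mul_val s t := by
    rw [← mulAt_rfl, SpatialProductSystem.mulAt_tmul, ξ.mulAt_val, η.mulAt_val]
  val_zero := by rw [ξ.val_zero, η.val_zero]; rfl

/-- A Trotter type formula: a unit lies in every multiplicative family of closed subspaces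
containing vectors that approximate it infinitesimally. -/
theorem Unit.mem_of_hasDerivAt {E : ProductSystem.{u} ℂ} (v : E.Unit) (z : ∀ t, E t)
    {K : ∀ t, Submodule ℂ (E t)} (hK : ∀ t, IsClosed (K t : Set (E t)))
    (hone : E.scalar 1 ∈ K 0)
    (hmul : ∀ {s t r : ℝ≥0} (h : s + t = r) {x : E s} {y : E t}, x ∈ K s → y ∈ K t →
      E.mulAt h x y ∈ K r)
    (hz : ∀ t, z t ∈ K t) {N P Q : ℝ → ℂ} {α : ℂ} (hN0 : N 0 = 1) (hP0 : P 0 = 1) (hQ0 : Q 0 = 1)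
    (hN : HasDerivAt N α 0) (hP : HasDerivAt P α 0) (hQ : HasDerivAt Q α 0)
    (hvv : ∀ t : ℝ≥0, (inner ℂ (v.val t) (v.val t) : ℂ) = N t)
    (hvz : ∀ t : ℝ≥0, (inner ℂ (v.val t) (z t) : ℂ) = P t)
    (hzz : ∀ t : ℝ≥0, (inner ℂ (z t) (z t) : ℂ) = Q t) (t : ℝ≥0) : v.val t ∈ K t := by
  have hpow (n : ℕ) : ∀ s t : ℝ≥0, (n : ℝ≥0) * s = t → ∃ p ∈ K t,
      (inner ℂ (v.val t) (v.val t) : ℂ) = N s ^ n ∧ (inner ℂ (v.val t) p : ℂ) = P s ^ n ∧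
        (inner ℂ p p : ℂ) = Q s ^ n := by
    induction n with
    | zero =>
      intro s t hst
      obtain rfl : (0 : ℝ≥0) = t := by simpa using hst
      refine ⟨E.scalar 1, hone, ?_⟩
      simp only [v.val_zero, pow_zero, inner_scalar_one, and_self]
    | succ n ih =>
      intro s t hst
      have hst' : (n : ℝ≥0) * s + s = t := by rw [← hst, Nat.cast_succ, add_mul, one_mul]
      obtain ⟨p, hp, h1, h2, h3⟩ := ih s _ rfl
      refine ⟨E.mulAt hst' p (z s), hmul hst' hp (hz s), ?_⟩
      simp only [← v.mulAt_val hst', inner_mulAt, h1, h2, h3, hvv, hvz, hzz, pow_succ, and_self]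
  -- There are `n + 1` steps, so that the division of `t` is always legitimate.
  have hdiv (n : ℕ) : ((n + 1 : ℕ) : ℝ≥0) * (t / (n + 1 : ℕ)) = t :=
    mul_div_cancel₀ _ (Nat.cast_ne_zero.2 n.succ_ne_zero)
  choose p hpK hpN hpP hpQ using fun n : ℕ => hpow (n + 1) _ t (hdiv n)
  have hlim {R : ℝ → ℂ} (h0 : R 0 = 1) (hR : HasDerivAt R α 0) :
      Tendsto (fun n : ℕ => R ((t / (n + 1 : ℕ) : ℝ≥0) : ℝ) ^ (n + 1)) atTop
        (𝓝 (Complex.exp ((t : ℝ) * α))) := by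
    have := (tendsto_pow_of_hasDerivAt h0 hR t).comp (tendsto_add_atTop_nat 1)
    exact this.congr fun n => by simp
  have hL : (inner ℂ (v.val t) (v.val t) : ℂ) = Complex.exp ((t : ℝ) * α) :=
    tendsto_nhds_unique (tendsto_const_nhds.congr hpN) (hlim hN0 hN)
  have hLre : ‖v.val t‖ ^ 2 = (Complex.exp ((t : ℝ) * α)).re := by
    rw [← hL, ← inner_self_eq_norm_sq (𝕜 := ℂ)]
    rfl
  -- The three terms tend to `L - 2 * L + L = 0` with `L` the real part of `exp (t * α)`, since `N`,
  -- `P` and `Q` share the derivative `α`.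
  have hnorm (n : ℕ) : ‖v.val t - p n‖ ^ 2 = (Complex.exp ((t : ℝ) * α)).re -
      2 * (P ((t / (n + 1 : ℕ) : ℝ≥0) : ℝ) ^ (n + 1)).re +
        (Q ((t / (n + 1 : ℕ) : ℝ≥0) : ℝ) ^ (n + 1)).re := by
    rw [@norm_sub_sq ℂ, hLre, hpP, ← inner_self_eq_norm_sq (𝕜 := ℂ) (p n), hpQ]
    rfl
  have htend : Tendsto (fun n => ‖v.val t - p n‖ ^ 2) atTop (𝓝 0) := by
    have hre {f : ℕ → ℂ} {L : ℂ} (hf : Tendsto f atTop (𝓝 L)) :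
        Tendsto (fun n => (f n).re) atTop (𝓝 L.re) := (Complex.continuous_re.tendsto L).comp hf
    have h := (((hre (hlim hP0 hP)).const_mul 2).const_sub (Complex.exp ((t : ℝ) * α)).re).add
      (hre (hlim hQ0 hQ))
    refine (h.congr fun n => (hnorm n).symm).trans (le_of_eq ?_)
    congr 1
    ring
  have htend' : Tendsto p atTop (𝓝 (v.val t)) := by
    rw [tendsto_iff_norm_sub_tendsto_zero]
    have := htend.sqrt
    simpa [Real.sqrt_sq, norm_sub_rev] using this
  exact (hK t).mem_of_tendsto htend' (Eventually.of_forall hpK)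

theorem Unit.exists_eq_exp {E : ProductSystem.{u} ℂ} (ξ η : E.Unit)
    (h : Continuous fun t : ℝ≥0 => (inner ℂ (ξ.val t) (η.val t) : ℂ)) :
    ∃ c : ℂ, ∀ t : ℝ≥0, (inner ℂ (ξ.val t) (η.val t) : ℂ) = Complex.exp (c * (t : ℝ)) :=
  exists_eq_exp_of_map_add h (ξ.inner_zero η) (ξ.inner_add η)

/-- The Trotter formula applies to `z = ξ ⊗ ω' + ω ⊗ η - ω ⊗ ω'`. All inner products involved are
exponentials, and in `⟪ξ ⊗ η, z⟫` and `⟪z, z⟫` the exponents of the mixed terms cancel to first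
order, leaving the derivative `a + b` of `⟪ξ ⊗ η, ξ ⊗ η⟫`. -/
theorem Unit.tensor_mem {A : ProductSystem.{u} ℂ} {B : ProductSystem.{v} ℂ} {ξ ω : A.Unit}
    {η ω' : B.Unit} {K : ∀ t, Submodule ℂ ((A.tensor B) t)}
    (hK : ∀ t, IsClosed (K t : Set ((A.tensor B) t))) (hone : (A.tensor B).scalar 1 ∈ K 0)
    (hmul : ∀ {s t r : ℝ≥0} (h : s + t = r) {x : (A.tensor B) s} {y : (A.tensor B) t},
      x ∈ K s → y ∈ K t → (A.tensor B).mulAt h x y ∈ K r)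
    (hξω : ∀ t, tmul A B (ξ.val t) (ω'.val t) ∈ K t)
    (hωη : ∀ t, tmul A B (ω.val t) (η.val t) ∈ K t)
    (hωω : ∀ t, tmul A B (ω.val t) (ω'.val t) ∈ K t)
    (hω : ∀ t, (inner ℂ (ω.val t) (ω.val t) : ℂ) = 1)
    (hω' : ∀ t, (inner ℂ (ω'.val t) (ω'.val t) : ℂ) = 1)
    (hξ : A.IsContinuousSet {ξ, ω}) (hη : B.IsContinuousSet {η, ω'}) (t : ℝ≥0) :
    tmul A B (ξ.val t) (η.val t) ∈ K t := by
  obtain ⟨a, ha⟩ := ξ.exists_eq_exp ξ (hξ ξ (by simp) ξ (by simp))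
  obtain ⟨c, hc⟩ := ω.exists_eq_exp ξ (hξ ω (by simp) ξ (by simp))
  obtain ⟨c', hc'⟩ := ξ.exists_eq_exp ω (hξ ξ (by simp) ω (by simp))
  obtain ⟨b, hb⟩ := η.exists_eq_exp η (hη η (by simp) η (by simp))
  obtain ⟨d, hd⟩ := ω'.exists_eq_exp η (hη ω' (by simp) η (by simp))
  obtain ⟨d', hd'⟩ := η.exists_eq_exp ω' (hη η (by simp) ω' (by simp))
  have he (c : ℂ) : HasDerivAt (fun x : ℝ => Complex.exp (c * x)) c 0 := by
    have := ((hasDerivAt_id ((0 : ℝ) : ℂ)).const_mul c).cexp.comp_ofReal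
    simpa using this
  have hN : HasDerivAt (fun x : ℝ => Complex.exp (a * x) * Complex.exp (b * x)) (a + b) 0 := by
    refine ((he a).fun_mul (he b)).congr_deriv ?_
    simp
  have hP : HasDerivAt (fun x : ℝ => Complex.exp (a * x) * Complex.exp (d' * x) +
      Complex.exp (c' * x) * Complex.exp (b * x) -
      Complex.exp (c' * x) * Complex.exp (d' * x)) (a + b) 0 := by
    refine ((((he a).fun_mul (he d')).fun_add ((he c').fun_mul (he b))).fun_sub
      ((he c').fun_mul (he d'))).congr_deriv ?_
    simp
    ring
  have hQ : HasDerivAt (fun x : ℝ => Complex.exp (a * x) + Complex.exp (c' * x) *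
      Complex.exp (d * x) - Complex.exp (c' * x) + (Complex.exp (c * x) * Complex.exp (d' * x) +
      Complex.exp (b * x) - Complex.exp (d' * x)) - (Complex.exp (c * x) + Complex.exp (d * x) - 1))
      (a + b) 0 := by
    refine (((((he a).fun_add ((he c').fun_mul (he d))).fun_sub (he c')).fun_add
      ((((he c).fun_mul (he d')).fun_add (he b)).fun_sub (he d'))).fun_sub
      (((he c).fun_add (he d)).sub_const 1)).congr_deriv ?_
    simp
    ring
  refine (ξ.tensor η).mem_of_hasDerivAt (fun t => tmul A B (ξ.val t) (ω'.val t) +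
    tmul A B (ω.val t) (η.val t) - tmul A B (ω.val t) (ω'.val t)) hK hone hmul
    (fun t => sub_mem (add_mem (hξω t) (hωη t)) (hωω t)) ?_ ?_ ?_ hN hP hQ ?_ ?_ ?_ t
  · simp
  · simp
  · simp
  · intro t
    simp only [Unit.tensor, SpatialProductSystem.inner_tmul, ha, hb]
  · intro t
    simp only [Unit.tensor, inner_add_right, inner_sub_right, SpatialProductSystem.inner_tmul, ha,
      hb, hc', hd']
  · intro t
    simp only [inner_add_left, inner_sub_left, inner_add_right, inner_sub_right,
      SpatialProductSystem.inner_tmul, ha, hb, hc, hc', hd, hd', hω, hω', one_mul, mul_one]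
    ring

end ProductSystem

/-! ### Adjusting the reference unit of a type I system. -/

namespace SpatialProductSystem

open ProductSystem Filter Topology

/-- The inner product of the reference unit with a word of units factors over the letters. Were all
factors of positive time zero, the unit vector `A.ref.val 1` would be orthogonal to a total set. -/
theorem exists_inner_ref_ne_zero {A : SpatialProductSystem.{u} ℂ} {S : Set A.Unit}
    (hS : Dense (Submodule.span ℂ (A.prodsAt (W := ℝ≥0 × S) (fun a => a.1)
      (fun a => a.2.1.val a.1) 1) : Set (A.space 1))) :
    ∃ ξ ∈ S, ∃ r : ℝ≥0, 0 < r ∧ (inner ℂ (A.ref.val r) (ξ.val r) : ℂ) ≠ 0 := by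
  by_contra! hcon
  have hword (l : List (ℝ≥0 × S)) : 0 < totalTime (fun a => a.1) l →
      (inner ℂ (A.ref.val (totalTime (fun a : ℝ≥0 × S => a.1) l))
        (A.prod (fun a : ℝ≥0 × S => a.1) (fun a => a.2.1.val a.1) l) : ℂ) = 0 := by
    induction l with
    | nil => exact fun h => absurd h (lt_irrefl _)
    | cons a l ih =>
      intro h
      have h1 : A.ref.val (totalTime (fun a : ℝ≥0 × S => a.1) (a :: l)) =
        A.mulAt rfl (A.ref.val a.1) (A.ref.val (totalTime (fun a : ℝ≥0 × S => a.1) l)) :=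
          (A.ref.mulAt_val rfl).symm
      rw [h1]
      refine (inner_mulAt (E := A.toProductSystem) rfl _ _ _ _).trans ?_
      -- A letter of time zero gives no vanishing factor, but then the remaining word still has
      -- positive total time.
      rcases eq_zero_or_pos a.1 with ha | ha
      · rw [ih, mul_zero]
        change 0 < a.1 + _ at h
        rwa [ha, zero_add] at h
      · rw [hcon a.2.1 a.2.2 _ ha, zero_mul]
  have h0 := (innerSL ℂ (A.ref.val 1)).eq_of_dense_span 0 ?_
    (Submodule.mem_topologicalClosure_of_dense hS (A.ref.val 1))
  · rw [innerSL_apply_apply, A.inner_ref] at h0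
    exact one_ne_zero h0
  · rintro _ ⟨l, h, rfl⟩
    have hl (T : ℝ≥0) (h : totalTime (fun a : ℝ≥0 × S => a.1) l = T) (hT : 0 < T) :
        (inner ℂ (A.ref.val T) (timeCast (𝕜 := ℂ) (H := A.toProductSystem) h
          (A.prod (fun a : ℝ≥0 × S => a.1) (fun a => a.2.1.val a.1) l)) : ℂ) = 0 := by
      subst h
      exact hword l hT
    exact hl 1 h one_pos

/-- The reference unit of a type I system differs by a character from a unit that is continuous
with respect to the generating set. -/
theorem exists_continuous_ref {A : SpatialProductSystem.{u} ℂ} {S : Set A.Unit}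
    (hS : A.IsContinuousSet S)
    (hd : Dense (Submodule.span ℂ (A.prodsAt (W := ℝ≥0 × S) (fun a => a.1)
      (fun a => a.2.1.val a.1) 1) : Set (A.space 1))) :
    ∃ (ω : A.Unit) (χ : ℝ≥0 → ℂ), (∀ t, ω.val t = χ t • A.ref.val t) ∧
      (∀ t, (inner ℂ (ω.val t) (ω.val t) : ℂ) = 1) ∧
      ∀ ξ ∈ S, A.IsContinuousSet {ξ, ω} := by
  obtain ⟨ζ, hζ, r, hr, hne⟩ := exists_inner_ref_ne_zero hd
  set φ : ℝ≥0 → ℂ := fun t => inner ℂ (A.ref.val t) (ζ.val t) with hφ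
  have hφ0 : φ 0 = 1 := A.ref.inner_zero ζ
  have hφm (s t) : φ (s + t) = φ s * φ t := A.ref.inner_add ζ s t
  -- A zero at `t` would persist at all later times, in particular at a multiple `n * r ≥ t`, where
  -- `φ` is `φ r ^ n ≠ 0`.
  have hφne (t) : φ t ≠ 0 := by
    obtain ⟨n, hn⟩ := exists_nat_ge (t / r)
    rw [div_le_iff₀ hr] at hn
    obtain ⟨d, hd⟩ := exists_add_of_le hn
    have h1 : φ (n * r) ≠ 0 := by
      rw [map_natCast_mul_of_map_add hφ0 hφm]
      exact pow_ne_zero _ hne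
    rw [hd, hφm] at h1
    exact left_ne_zero_of_mul h1
  have hnormφ (t) : (‖φ t‖ : ℂ) ≠ 0 := by simpa using hφne t
  -- The phase of `φ` need not be continuous. Moving it into the reference unit makes the inner
  -- product with `ζ` positive.
  set χ : ℝ≥0 → ℂ := fun t => φ t / ‖φ t‖ with hχ
  have hχχ (t) : (starRingEnd ℂ) (χ t) * χ t = 1 := by
    rw [mul_comm, Complex.mul_conj, Complex.normSq_eq_norm_sq]
    simp [hχ, hφne t]
  have hχφ (t) : (starRingEnd ℂ) (χ t) * φ t = ‖φ t‖ := by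
    simp only [hχ, map_div₀, Complex.conj_ofReal]
    rw [div_mul_eq_mul_div, mul_comm, Complex.mul_conj, Complex.normSq_eq_norm_sq,
      div_eq_iff (hnormφ t)]
    push_cast
    ring
  let ω : A.Unit := A.ref.smul χ (by simp [hχ, hφ0]) fun s t => by
    simp only [hχ, hφm, norm_mul, Complex.ofReal_mul]
    rw [mul_div_mul_comm]
  have hω (t) : ω.val t = χ t • A.ref.val t := rfl
  have hωω (t) : (inner ℂ (ω.val t) (ω.val t) : ℂ) = 1 := by
    rw [hω, inner_smul_left, inner_smul_right, A.inner_ref, mul_one, hχχ]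
  have hωζ (t) : (inner ℂ (ω.val t) (ζ.val t) : ℂ) = ‖φ t‖ := by
    rw [hω, inner_smul_left, ← hχφ]
  have hωn (t) : ‖ω.val t‖ = 1 := by
    rw [@norm_eq_sqrt_re_inner ℂ, hωω]
    simp
  have hcn {ξ : A.Unit} (hξ : ξ ∈ S) : Tendsto (fun t => ‖ξ.val t‖) (𝓝 0) (𝓝 1) := by
    have : Continuous fun t => ‖ξ.val t‖ := by
      have h1 : (fun t => ‖ξ.val t‖) = fun t => √(inner ℂ (ξ.val t) (ξ.val t) : ℂ).re :=
        funext fun t => @norm_eq_sqrt_re_inner ℂ _ _ _ _ _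
      rw [h1]
      exact (Complex.continuous_re.comp (hS ξ hξ ξ hξ)).sqrt
    refine this.tendsto' _ _ ?_
    rw [ξ.val_zero, LinearIsometryEquiv.norm_map, norm_one]
  have hle (t) : ‖φ t‖ ≤ ‖ζ.val t‖ := by
    have := norm_inner_le_norm (𝕜 := ℂ) (A.ref.val t) (ζ.val t)
    rwa [norm_ref, one_mul] at this
  have hpos (t) : 0 < ‖φ t‖ := norm_pos_iff.2 (hφne t)
  have hζpos (t) : 0 < ‖ζ.val t‖ := (hpos t).trans_le (hle t)
  have hζm (s t) : ‖ζ.val (s + t)‖ = ‖ζ.val s‖ * ‖ζ.val t‖ := by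
    rw [← ζ.mulAt_val rfl, mulAt_rfl, LinearIsometry.norm_map, TensorProduct.norm_tmul]
  have hφlim : Tendsto (fun t => ‖φ t‖) (𝓝 0) (𝓝 1) := by
    -- By Cauchy–Schwarz the quotient is at most `1`. Being positive and multiplicative it tends to
    -- `1` without any continuity assumption.
    have h1 : Tendsto (fun t => ‖φ t‖ / ‖ζ.val t‖) (𝓝 0) (𝓝 1) := by
      refine tendsto_one_of_map_add ?_ ?_ (fun t => div_pos (hpos t) (hζpos t))
        fun t => (div_le_one (hζpos t)).2 (hle t)
      · rw [hφ0, ζ.val_zero, LinearIsometryEquiv.norm_map, norm_one, div_one]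
      · intro s t
        rw [hφm, norm_mul, hζm, mul_div_mul_comm]
    have h2 := h1.mul (hcn hζ)
    rw [one_mul] at h2
    exact h2.congr fun t => div_mul_cancel₀ _ (hζpos t).ne'
  have hdiff : Tendsto (fun t => ‖ω.val t - ζ.val t‖) (𝓝 0) (𝓝 0) := by
    have h1 (t) : ‖ω.val t - ζ.val t‖ = √(1 - 2 * ‖φ t‖ + ‖ζ.val t‖ ^ 2) := by
      have h2 := @norm_sub_sq ℂ _ _ _ _ (ω.val t) (ζ.val t)
      rw [hωζ, hωn, one_pow] at h2
      rw [← Real.sqrt_sq (norm_nonneg (ω.val t - ζ.val t)), h2]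
      simp
    have h2 := (((hφlim.const_mul 2).const_sub 1).add ((hcn hζ).pow 2)).sqrt
    simp only [h1]
    convert h2 using 2
    norm_num
  -- Near time zero `ω` is norm-close to `ζ`, so it inherits the continuity of `ζ` against `ξ`
  -- there, and multiplicativity spreads it to all times.
  have hcont {ξ : A.Unit} (hξ : ξ ∈ S) :
      Continuous fun t : ℝ≥0 => (inner ℂ (ω.val t) (ξ.val t) : ℂ) := by
    refine continuous_of_tendsto_one_of_map_add (ω.inner_add ξ) ?_
    have h1 : Tendsto (fun t => (inner ℂ (ω.val t - ζ.val t) (ξ.val t) : ℂ)) (𝓝 0) (𝓝 0) := by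
      refine squeeze_zero_norm (fun t => norm_inner_le_norm _ _) ?_
      simpa using hdiff.mul (hcn hξ)
    have h2 : Tendsto (fun t => (inner ℂ (ζ.val t) (ξ.val t) : ℂ)) (𝓝 0) (𝓝 1) :=
      (hS ζ hζ ξ hξ).tendsto' _ _ (ζ.inner_zero ξ)
    have h3 := h1.add h2
    rw [zero_add] at h3
    exact h3.congr fun t => by rw [inner_sub_left, sub_add_cancel]
  refine ⟨ω, χ, hω, hωω, fun ξ hξ => ?_⟩
  rintro _ (rfl | rfl) _ (rfl | rfl)
  · exact hS _ hξ _ hξ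
  · refine (Complex.continuous_conj.comp (hcont hξ)).congr fun t => ?_
    exact inner_conj_symm _ _
  · exact hcont hξ
  · simp only [hωω]
    exact continuous_const

/-! ### Unitarity for type I systems. -/

section TypeI

variable {A : SpatialProductSystem.{u} ℂ} {B : SpatialProductSystem.{v} ℂ}

/-- For type I systems the tensor product is generated by `A ⊗ ω` and `ω ⊗ B`. -/
theorem mem_of_isTypeI (hA : A.IsTypeI) (hB : B.IsTypeI)
    {K : ∀ t, Submodule ℂ ((A.toProductSystem.tensor B.toProductSystem) t)}
    (hK : ∀ t, IsClosed (K t : Set ((A.toProductSystem.tensor B.toProductSystem) t)))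
    (hone : (A.toProductSystem.tensor B.toProductSystem).scalar 1 ∈ K 0)
    (hmul : ∀ {s t r : ℝ≥0} (h : s + t = r)
      {x : (A.toProductSystem.tensor B.toProductSystem) s}
      {y : (A.toProductSystem.tensor B.toProductSystem) t},
      x ∈ K s → y ∈ K t → (A.toProductSystem.tensor B.toProductSystem).mulAt h x y ∈ K r)
    (hl : ∀ t a, (inlTensor A B).map t a ∈ K t) (hr : ∀ t b, (inrTensor A B).map t b ∈ K t)
    (t : ℝ≥0) (x : (A.toProductSystem.tensor B.toProductSystem) t) : x ∈ K t := by
  obtain ⟨S, hSc, hSd⟩ := hA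
  obtain ⟨S', hSc', hSd'⟩ := hB
  obtain ⟨ω, χ, hω, hωn, hωc⟩ := exists_continuous_ref hSc (hSd 1)
  obtain ⟨ω', χ', hω', hωn', hωc'⟩ := exists_continuous_ref hSc' (hSd' 1)
  have hleft (t) (a : A.space t) :
      tmul A.toProductSystem B.toProductSystem a (ω'.val t) ∈ K t := by
    rw [hω', ← tmulL_apply, map_smul]
    exact (K t).smul_mem _ (hl t a)
  have hright (t) (b : B.space t) :
      tmul A.toProductSystem B.toProductSystem (ω.val t) b ∈ K t := by
    rw [hω, ← tmulL_apply, map_smul, smul_apply]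
    exact (K t).smul_mem _ (hr t b)
  have hunits (ξ : S) (η : S') (t) :
      tmul A.toProductSystem B.toProductSystem (ξ.1.val t) (η.1.val t) ∈ K t :=
    Unit.tensor_mem hK hone hmul (fun t => hleft t _) (fun t => hright t _) (fun t => hleft t _)
      hωn hωn' (hωc ξ.1 ξ.2) (hωc' η.1 η.2) t
  -- Approximate `b` by words of units and break the unit `ξ` at the same times as each word.
  have hunit (ξ : S) (t) (b : B.space t) :
      tmul A.toProductSystem B.toProductSystem (ξ.1.val t) b ∈ K t := by
    refine (tmulL A.toProductSystem B.toProductSystem t (ξ.1.val t)).map_mem_of_dense_span (hK t) ?_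
      (Submodule.mem_topologicalClosure_of_dense (hSd' t) b)
    rintro _ ⟨l, rfl, rfl⟩
    clear b
    induction l with
    | nil =>
      change tmul A.toProductSystem B.toProductSystem (ξ.1.val 0) (B.scalar 1) ∈ K 0
      rw [ξ.1.val_zero]
      exact hone
    | cons c l ih =>
      have := hmul rfl (hunits ξ c.2 c.1) ih
      rw [tmulL_apply, mulAt_tmul, ξ.1.mulAt_val] at this
      exact this
  -- Here the left factor is a word, and `b` is split along it by density of products in `B`.
  have hword (l : List (ℝ≥0 × S)) (b : B.space (totalTime (fun a => a.1) l)) :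
      tmul A.toProductSystem B.toProductSystem
        (A.prod (fun a : ℝ≥0 × S => a.1) (fun a => a.2.1.val a.1) l) b ∈ K _ := by
    induction l with
    | nil =>
      obtain ⟨c, rfl⟩ := B.scalar.surjective b
      change (A.toProductSystem.tensor B.toProductSystem).scalar c ∈ K 0
      rw [scalar_eq_smul]
      exact (K 0).smul_mem _ hone
    | cons c l ih =>
      refine B.map_mem_of_mulAt rfl (tmulL A.toProductSystem B.toProductSystem _
        (A.prod (fun a : ℝ≥0 × S => a.1) (fun a => a.2.1.val a.1) (c :: l))) (hK _) (fun b b' => ?_) b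
      have := hmul rfl (hunit c.2 c.1 b) (ih b')
      rw [mulAt_tmul] at this
      exact this
  have htmul (a : A.space t) (b : B.space t) :
      tmul A.toProductSystem B.toProductSystem a b ∈ K t := by
    refine ((tmulL A.toProductSystem B.toProductSystem t).flip b).map_mem_of_dense_span (hK t) ?_
      (Submodule.mem_topologicalClosure_of_dense (hSd t) a)
    rintro _ ⟨l, rfl, rfl⟩
    exact hword l b
  refine Completion.induction_on (p := fun x => x ∈ K t) x (hK t) fun z => ?_
  induction z with
  | zero => rw [Completion.coe_zero]; exact zero_mem _
  | add x y hx hy => rw [Completion.coe_add]; exact add_mem hx hy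
  | tmul a b => exact htmul a b

/-- The ranges of an isometric morphism are closed and form a multiplicative family; here they
contain the generators `a ⊗ ω` and `ω ⊗ b`, hence everything. -/
theorem ExtendsReplacement.isUnitary {F : SpatialProductSystem.{w} ℂ}
    {i : A.Morphism F.toProductSystem} {j : B.Morphism F.toProductSystem}
    {U : F.Morphism (A.toProductSystem.tensor B.toProductSystem)}
    (hU : ExtendsReplacement i j U) (hiso : U.IsIsometric) (hA : A.IsTypeI) (hB : B.IsTypeI) :
    U.IsUnitary := by
  refine fun t => ⟨hiso t, fun x => ?_⟩
  refine mem_of_isTypeI hA hB (K := fun t => LinearMap.range (U.map t).toLinearMap) ?_ ?_ ?_ ?_ ?_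
    t x
  · intro t
    exact (hiso t).isClosedEmbedding.isClosed_range
  · exact ⟨F.scalar 1, U.map_scalar 1⟩
  · rintro s t r h _ _ ⟨x, rfl⟩ ⟨y, rfl⟩
    exact ⟨F.mulAt h x y, U.map_mulAt h x y⟩
  · exact fun t a => ⟨_, hU.map_left t a⟩
  · exact fun t b => ⟨_, hU.map_right t b⟩

end TypeI

end SpatialProductSystem

open SpatialProductSystem in
theorem proposition6p8 (A : SpatialProductSystem.{u} ℂ) (B : SpatialProductSystem.{v} ℂ) :
    (∃ (F : SpatialProductSystem.{max u v} ℂ) (i : A.Morphism F.toProductSystem)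
      (j : B.Morphism F.toProductSystem), IsProduct A B F i j) ∧
    ∀ (F : SpatialProductSystem.{w} ℂ) (i : A.Morphism F.toProductSystem)
      (j : B.Morphism F.toProductSystem), IsProduct A B F i j →
      (∃! U : F.Morphism (A.toProductSystem.tensor B.toProductSystem),
        ExtendsReplacement i j U) ∧
      ∀ U : F.Morphism (A.toProductSystem.tensor B.toProductSystem),
        ExtendsReplacement i j U →
          U.IsIsometric ∧ (A.IsTypeI → B.IsTypeI → U.IsUnitary) := by
  refine ⟨⟨product A B, inlProduct A B, inrProduct A B, isProduct_product⟩, fun F i j hF => ?_⟩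
  obtain ⟨V, hV, hiso⟩ := hF.exists_morphism
  refine ⟨⟨V, hV, fun U hU => hF.morphism_ext hU hV⟩, fun U hU => ?_⟩
  obtain rfl := hF.morphism_ext hU hV
  exact ⟨hiso, hU.isUnitary hiso⟩
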